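/- Let $k \ge 2$ be an integer, let $\varepsilon > 0$ be real, and put $\eta_{k,\varepsilon} = \varepsilon^2/(2\ln k)$. A directed (undirected) cycle cover $C$ is a set of vertex-disjoint directed cycles of length at least $2$ (undirected cycles of length at least $3$) such that every vertex lies on exactly one of them; we identify $C$ with its set of edges. Edge weights are $w = (w_1,\dots,w_k)$ with $w_i(e) \in \mathbb{Q}_{\ge 0}$, and $w_i(S) = \sum_{e\in S} w_i(e)$ for a set $S$ of edges. For $\gamma > 0$, the pair $(C,w)$ is $\gamma$-light if $w_i(e) \le w_i(C)/\gamma$ for all $e \in C$ and all $i \in \{1,\dots,k\}$. An $\alpha$-decomposition of $C$ is a subset $P \subseteq C$ that forms a collection of vertex-disjoint paths and satisfies $w_i(P) \ge \alpha\, w_i(C)$ for all $i \in \{1,\dots,k\}$. Then, for fixed $k$ and $\varepsilon$: 1. There is a deterministic algorithm, with running time polynomial in the (binary) input size, that on input of any $1/\eta_{k,\varepsilon}$-light pair $(C,w)$ with $C$ a directed cycle cover computes a $\bigl(\frac12-\varepsilon\bigr)$-decomposition of $C$. 2. There is a deterministic algorithm, with running time polynomial in the (binary) input size, that on input of any $1/\eta_{k,\varepsilon}$-light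 pair $(C,w)$ with $C$ an undirected cycle cover computes a $\bigl(\frac23-\varepsilon\bigr)$-decomposition of $C$. -/

import Mathlib

/-! ### Multi-criteria edge weights on a cycle cover -/

namespace CycleDecomp

/-- `w_i(S)`: the weight of a set `S` of edges with respect to objective `i`. -/
def weight {E : Type} {k : ℕ} (w : Fin k → E → ℚ≥0) (i : Fin k) (S : Finset E) : ℚ≥0 :=
  ∑ e ∈ S, w i e

/-- `(C, w)` is `γ`-light: `w(e) ≤ w(C) / γ` componentwise, for every edge `e ∈ C`. -/
def IsLight {E : Type} {k : ℕ} (γ : ℝ) (C : Finset E) (w : Fin k → E → ℚ≥0) : Prop :=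
  ∀ e ∈ C, ∀ i, (w i e : ℝ) ≤ (weight w i C : ℝ) / γ

/-- `η_{k,ε} = ε² / (2 ln k)`. -/
noncomputable def eta (k : ℕ) (ε : ℝ) : ℝ := ε ^ 2 / (2 * Real.log k)

/-- `w(P) ≥ α · w(C)`, componentwise. -/
def KeepsFraction {E : Type} {k : ℕ} (α : ℝ) (C : Finset E) (w : Fin k → E → ℚ≥0)
    (P : Finset E) : Prop :=
  ∀ i, α * (weight w i C : ℝ) ≤ (weight w i P : ℝ)

/-! ### Directed cycle covers -/

/-- A directed cycle cover of the vertex set `V`, as a set of directed edges `(u, v)`: there are no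
loops, and every vertex has exactly one outgoing and exactly one incoming edge. -/
def IsDirectedCycleCover {V : Type} (C : Finset (V × V)) : Prop :=
  (∀ e ∈ C, e.1 ≠ e.2) ∧ (∀ u, ∃! v, (u, v) ∈ C) ∧ (∀ v, ∃! u, (u, v) ∈ C)

/-- A collection of vertex-disjoint directed paths: every vertex has at most one outgoing and at
most one incoming edge, and there is no directed closed walk. -/
def IsDirectedPathCollection {V : Type} (P : Finset (V × V)) : Prop :=
  (∀ u v v', (u, v) ∈ P → (u, v') ∈ P → v = v') ∧
  (∀ u u' v, (u, v) ∈ P → (u', v) ∈ P → u = u') ∧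
  (∀ v, ¬ Relation.TransGen (fun a b => (a, b) ∈ P) v v)

/-- `P` is an `α`-decomposition of the directed cycle cover `C`. -/
def IsDirectedDecomposition {V : Type} {k : ℕ} (α : ℝ) (C : Finset (V × V))
    (w : Fin k → V × V → ℚ≥0) (P : Finset (V × V)) : Prop :=
  P ⊆ C ∧ IsDirectedPathCollection P ∧ KeepsFraction α C w P

/-! ### Undirected cycle covers -/

/-- The degree of `v` in a set of undirected edges. -/
def degree {V : Type} [DecidableEq V] (S : Finset (Sym2 V)) (v : V) : ℕ :=
  (S.filter (fun e => v ∈ e)).card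

/-- An undirected cycle cover of the vertex set `V`, as a set of undirected edges: there are no
loops, and every vertex has degree two. (In a simple graph all cycles have length at least 3.) -/
def IsUndirectedCycleCover {V : Type} [DecidableEq V] (C : Finset (Sym2 V)) : Prop :=
  (∀ e ∈ C, ¬ e.IsDiag) ∧ ∀ v, degree C v = 2

/-- A collection of vertex-disjoint undirected paths: no loops, all degrees at most two, and no
cycle. -/
def IsUndirectedPathCollection {V : Type} [DecidableEq V] (P : Finset (Sym2 V)) : Prop :=
  (∀ e ∈ P, ¬ e.IsDiag) ∧ (∀ v, degree P v ≤ 2) ∧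
    (SimpleGraph.fromEdgeSet (P : Set (Sym2 V))).IsAcyclic

/-- `P` is an `α`-decomposition of the undirected cycle cover `C`. -/
def IsUndirectedDecomposition {V : Type} [DecidableEq V] {k : ℕ} (α : ℝ) (C : Finset (Sym2 V))
    (w : Fin k → Sym2 V → ℚ≥0) (P : Finset (Sym2 V)) : Prop :=
  P ⊆ C ∧ IsUndirectedPathCollection P ∧ KeepsFraction α C w P

/-! ### The machine model

A deterministic random access machine with logarithmic (bit) cost and structured control. The
memory consists of arrays `M a : ℕ → ℕ` of natural numbers; a program is a finite object and
hence names only finitely many arrays `a`, while indices into an array are computed.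
Every number that is computed or read, hence also every address that is used, is charged its
binary length, so polynomial time on this machine is polynomial time on Turing machines. -/

/-- The memory: cell `i` of array `a` holds `M a i`. -/
abbrev Mem := ℕ → ℕ → ℕ

/-- Expressions: constants, reading a cell of an array, sum, truncated difference, product. -/
inductive Expr : Type
  | const (c : ℕ) : Expr
  | read (a : ℕ) (i : Expr) : Expr
  | add (x y : Expr) : Expr
  | sub (x y : Expr) : Expr
  | mul (x y : Expr) : Expr

/-- The value of an expression. -/
def Expr.val (M : Mem) : Expr → ℕ
  | .const c => c
  | .read a i => M a (i.val M)
  | .add x y => x.val M + y.val M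
  | .sub x y => x.val M - y.val M
  | .mul x y => x.val M * y.val M

/-- The time to evaluate an expression: every node of the expression costs one step plus the
binary length of its value. -/
def Expr.cost (M : Mem) : Expr → ℕ
  | .const c => 1 + c.size
  | .read a i => i.cost M + 1 + (M a (i.val M)).size
  | .add x y => x.cost M + y.cost M + 1 + (x.val M + y.val M).size
  | .sub x y => x.cost M + y.cost M + 1 + (x.val M - y.val M).size
  | .mul x y => x.cost M + y.cost M + 1 + (x.val M * y.val M).size

/-- Programs. A condition holds if its value is nonzero. -/
inductive Cmd : Type
  | skip : Cmd
  | write (a : ℕ) (i x : Expr) : Cmd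
  | seq (p q : Cmd) : Cmd
  | ite (b : Expr) (p q : Cmd) : Cmd
  | loop (b : Expr) (p : Cmd) : Cmd

/-- Writing `x` into cell `i` of array `a`. -/
def Mem.write (M : Mem) (a i x : ℕ) : Mem := Function.update M a (Function.update (M a) i x)

/-- `Run p M M' t`: started on memory `M`, the program `p` halts after exactly `t` time units with
memory `M'`. -/
inductive Run : Cmd → Mem → Mem → ℕ → Prop
  | skip (M : Mem) : Run .skip M M 1
  | write (M : Mem) (a : ℕ) (i x : Expr) :
      Run (.write a i x) M (M.write a (i.val M) (x.val M)) (i.cost M + x.cost M + 1)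
  | seq {p q : Cmd} {M M' M'' : Mem} {s t : ℕ} :
      Run p M M' s → Run q M' M'' t → Run (.seq p q) M M'' (s + t)
  | iteTrue {b : Expr} {p q : Cmd} {M M' : Mem} {t : ℕ} :
      b.val M ≠ 0 → Run p M M' t → Run (.ite b p q) M M' (b.cost M + 1 + t)
  | iteFalse {b : Expr} {p q : Cmd} {M M' : Mem} {t : ℕ} :
      b.val M = 0 → Run q M M' t → Run (.ite b p q) M M' (b.cost M + 1 + t)
  | loopStep {b : Expr} {p : Cmd} {M M' M'' : Mem} {s t : ℕ} :
      b.val M ≠ 0 → Run p M M' s → Run (.loop b p) M' M'' t →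
        Run (.loop b p) M M'' (b.cost M + 1 + s + t)
  | loopExit {b : Expr} {p : Cmd} {M : Mem} :
      b.val M = 0 → Run (.loop b p) M M (b.cost M + 1)

/-- The machine is deterministic: the result and the running time are determined by the program
and the initial memory. -/
theorem Run.deterministic {p : Cmd} {M M₁ M₂ : Mem} {t₁ t₂ : ℕ}
    (h₁ : Run p M M₁ t₁) (h₂ : Run p M M₂ t₂) : M₁ = M₂ ∧ t₁ = t₂ := by
  induction h₁ generalizing M₂ t₂ with
  | skip M => cases h₂; exact ⟨rfl, rfl⟩
  | write M a i x => cases h₂; exact ⟨rfl, rfl⟩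
  | seq _ _ ih₁ ih₂ =>
    cases h₂ with
    | seq a b =>
      obtain ⟨rfl, rfl⟩ := ih₁ a
      obtain ⟨rfl, rfl⟩ := ih₂ b
      exact ⟨rfl, rfl⟩
  | iteTrue hb _ ih =>
    cases h₂ with
    | iteTrue _ a => obtain ⟨rfl, rfl⟩ := ih a; exact ⟨rfl, rfl⟩
    | iteFalse hb' _ => exact absurd hb' hb
  | iteFalse hb _ ih =>
    cases h₂ with
    | iteTrue hb' _ => exact absurd hb hb'
    | iteFalse _ a => obtain ⟨rfl, rfl⟩ := ih a; exact ⟨rfl, rfl⟩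
  | loopStep hb _ _ ih₁ ih₂ =>
    cases h₂ with
    | loopStep _ a b =>
      obtain ⟨rfl, rfl⟩ := ih₁ a
      obtain ⟨rfl, rfl⟩ := ih₂ b
      exact ⟨rfl, rfl⟩
    | loopExit hb' => exact absurd hb' hb
  | loopExit hb =>
    cases h₂ with
    | loopStep hb' _ _ => exact absurd hb hb'
    | loopExit _ => exact ⟨rfl, rfl⟩

/-! ### Input and output -/

/-- The initial memory: the input word stands in array `0`, and all other cells are `0`. -/
def initMem (x : List ℕ) : Mem := fun a i => if a = 0 then x.getD i 0 else 0

/-- The size of an input word in bits, with one delimiter per number. -/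
def inputSize (x : List ℕ) : ℕ := (x.map (fun c => c.size + 1)).sum

/-- One weighted edge as a list of numbers: its two endpoints, followed by numerator and
denominator of its `k` weights. -/
def encodeEdge {n k : ℕ} (w : Fin k → Fin n × Fin n → ℚ≥0) (e : Fin n × Fin n) : List ℕ :=
  (e.1 : ℕ) :: (e.2 : ℕ) :: (List.ofFn (fun i => [(w i e).num, (w i e).den])).flatten

/-- The input word: the number of vertices, the number of edges, and the weighted edges. -/
def encode {n k : ℕ} (l : List (Fin n × Fin n)) (w : Fin k → Fin n × Fin n → ℚ≥0) : List ℕ :=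
  n :: l.length :: (l.map (encodeEdge w)).flatten

/-- The set of edges returned in array `1` of the final memory: it contains the `j`-th edge of the
input list `l` if and only if cell `j` of array `1` is nonzero. -/
def returnedEdges {E : Type} [DecidableEq E] (l : List E) (M : Mem) : Finset E :=
  (Finset.univ.filter (fun j : Fin l.length => M 1 j ≠ 0)).image l.get

/-- The undirected edge with the given endpoints. -/
def toUndirected {V : Type} (e : V × V) : Sym2 V := s(e.1, e.2)

end CycleDecomp

/-!
Call two edges of a directed cycle cover a *block* if they are consecutive on a cycle, and three
edges of an undirected cycle cover a *block* if they form a path or a triangle; let `r = 2` or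
`r = 3` be the number of edges of a block. The algorithm goes through all `r`-tuples of edges. A
tuple that is a block of so far unused edges becomes used, and one of its edges is dropped. All
other edges are kept, in particular those that are never used.

*Every cycle is broken.* In the end every block contains a used edge. A cycle of kept edges would
be an entire cycle of the cover (`not_transGen_returnedEdges`, `mem_edges_of_isCycle`), hence
contain a block, hence a used edge, hence all edges of the block that the algorithm formed around
this edge, of which one edge is dropped.

*Enough weight is kept.* Let `y_i(e) = w_i(e) / w_i(C) ≤ η`. If edge `d` of a block `B` is
dropped, then the loss of objective `i` exceeds that of an average choice by
`x_i = y_i(d) - y_i(B) / r`. The average of `1 + λ x_i` over the choices of `d` is `1`, so `d` can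
be chosen such that the potential `∑ i, ∏ B, (1 + λ x_i(B))`, which is `k` in the beginning, does
not increase (`exists_choice`). On the other hand `1 + z ≥ exp (z - z²)` for `z ≥ -1/2`, and
`x_i² ≤ 4/9 η y_i(B)` (`exp_le_factor`), so every single product is at least
`exp (λ ∑ B, x_i(B) - 4/9 λ² η)`. Comparing with `k` gives `∑ B, x_i(B) ≤ ln k / λ + 4/9 λ η`,
which is at most `ε` if `λ ε / ln k` lies between `3/2` and `2` (`Invariant.keeps`). As an average
choice loses at most the fraction `1 / r`, the fraction `1 - 1 / r - ε` is kept. Nothing has to be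
kept if `ε ≥ 1 - 1 / r`.

*Running time.* The potentials are exact fractions. The number `k` of objectives is fixed, so the
body of the loops is loop-free, and a loop-free program takes time linear in the bit length of the
memory (`Cmd.LoopFree.exists_run`). Each new block lengthens the potentials by an additive term
that is polynomial in the input size, and this happens at most once for each edge
(`Invariant.bounded`).
-/

namespace CycleDecomp

/-! ### Running time of loop-free programs -/

/-- Every memory cell holds a number of at most `b` bits. -/
def Mem.Bounded (b : ℕ) (M : Mem) : Prop := ∀ a i, (M a i).size ≤ b

/-- The number of nodes of an expression, where a constant counts with its bits. -/
def Expr.len : Expr → ℕ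
  | .const c => c.size + 1
  | .read _ i => i.len + 1
  | .add x y => x.len + y.len + 1
  | .sub x y => x.len + y.len + 1
  | .mul x y => x.len + y.len + 1

theorem size_add_le (x y : ℕ) : (x + y).size ≤ max x.size y.size + 1 := by
  rw [Nat.size_le, pow_succ]
  have hx : x < 2 ^ max x.size y.size :=
    (Nat.lt_size_self x).trans_le (Nat.pow_le_pow_right (by norm_num) (le_max_left _ _))
  have hy : y < 2 ^ max x.size y.size :=
    (Nat.lt_size_self y).trans_le (Nat.pow_le_pow_right (by norm_num) (le_max_right _ _))
  omega

theorem size_mul_le (x y : ℕ) : (x * y).size ≤ x.size + y.size := by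
  rw [Nat.size_le, pow_add]
  exact Nat.mul_lt_mul'' (Nat.lt_size_self x) (Nat.lt_size_self y)

theorem size_le_self (x : ℕ) : x.size ≤ x := Nat.size_le.2 Nat.lt_two_pow_self

theorem Expr.one_le_len (e : Expr) : 1 ≤ e.len := by cases e <;> simp [Expr.len]

theorem Expr.size_val_le {M : Mem} {b : ℕ} (hM : M.Bounded b) (e : Expr) :
    (e.val M).size ≤ e.len * (b + 1) := by
  induction e with
  | const c => simp only [Expr.val, Expr.len]; nlinarith
  | read a i _ =>
    have := hM a (i.val M)
    simp only [Expr.val, Expr.len]; nlinarith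
  | add x y hx hy =>
    have := size_add_le (x.val M) (y.val M)
    have : max (x.val M).size (y.val M).size ≤ (x.val M).size + (y.val M).size := by omega
    simp only [Expr.val, Expr.len]; nlinarith
  | sub x y hx hy =>
    have := Nat.size_le_size (Nat.sub_le (x.val M) (y.val M))
    simp only [Expr.val, Expr.len]; nlinarith
  | mul x y hx hy =>
    have := size_mul_le (x.val M) (y.val M)
    simp only [Expr.val, Expr.len]; nlinarith

theorem Expr.cost_le {M : Mem} {b : ℕ} (hM : M.Bounded b) (e : Expr) :
    e.cost M ≤ e.len ^ 2 * (b + 1) := by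
  have key : ∀ p q c d s : ℕ, 1 ≤ p → 1 ≤ q → c ≤ p ^ 2 * (b + 1) → d ≤ q ^ 2 * (b + 1) →
      s ≤ (p + q + 1) * (b + 1) → c + d + 1 + s ≤ (p + q + 1) ^ 2 * (b + 1) := by
    intro p q c d s hp hq hc hd hs
    have h : p ^ 2 + q ^ 2 + 1 + (p + q + 1) ≤ (p + q + 1) ^ 2 := by nlinarith
    nlinarith [Nat.mul_le_mul_right (b + 1) h]
  induction e with
  | const c => simp only [Expr.cost, Expr.len]; nlinarith [Nat.zero_le (c.size ^ 2 * (b + 1))]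
  | read a i hi =>
    have := hM a (i.val M)
    simp only [Expr.cost, Expr.len]; nlinarith [Nat.zero_le (i.len * (b + 1))]
  | add x y hx hy =>
    exact key _ _ _ _ _ x.one_le_len y.one_le_len hx hy (Expr.size_val_le hM (.add x y))
  | sub x y hx hy =>
    exact key _ _ _ _ _ x.one_le_len y.one_le_len hx hy (Expr.size_val_le hM (.sub x y))
  | mul x y hx hy =>
    exact key _ _ _ _ _ x.one_le_len y.one_le_len hx hy (Expr.size_val_le hM (.mul x y))

/-- The memory after running a loop-free program. (Loops are skipped.) -/
def Cmd.exec : Cmd → Mem → Mem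
  | .skip, M => M
  | .write a i x, M => M.write a (i.val M) (x.val M)
  | .seq p q, M => q.exec (p.exec M)
  | .ite b p q, M => if b.val M ≠ 0 then p.exec M else q.exec M
  | .loop _ _, M => M

/-- The program contains no loop. -/
def Cmd.LoopFree : Cmd → Prop
  | .skip => True
  | .write _ _ _ => True
  | .seq p q => p.LoopFree ∧ q.LoopFree
  | .ite _ p q => p.LoopFree ∧ q.LoopFree
  | .loop _ _ => False

theorem Mem.write_apply (M : Mem) (a i x b j : ℕ) :
    M.write a i x b j = if b = a ∧ j = i then x else M b j := by
  unfold Mem.write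
  by_cases hb : b = a
  · subst hb
    by_cases hj : j = i <;> simp [hj]
  · simp [hb]

/-- A loop-free program takes time linear in the bit length of the numbers in the memory, and
lengthens these numbers by at most a constant factor. -/
theorem Cmd.LoopFree.exists_run {p : Cmd} (hp : p.LoopFree) :
    ∃ K, ∀ M b, Mem.Bounded b M → (p.exec M).Bounded (K * (b + 1)) ∧
      ∃ t ≤ K * (b + 1), Run p M (p.exec M) t := by
  induction p with
  | skip =>
    exact ⟨1, fun M b hM => ⟨fun a i => (hM a i).trans (by omega), 1, by omega, .skip M⟩⟩
  | write a i x =>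
    refine ⟨i.len ^ 2 + x.len ^ 2 + x.len + 1, fun M b hM => ⟨fun a' j => ?_, _, ?_, .write ..⟩⟩
    · have h₁ := hM a' j
      have h₂ := x.size_val_le hM
      simp only [Cmd.exec, Mem.write_apply]
      split_ifs <;> nlinarith [Nat.zero_le (i.len ^ 2 * (b + 1)),
        Nat.zero_le (x.len ^ 2 * (b + 1)), Nat.zero_le (x.len * (b + 1))]
    · have h₁ := i.cost_le hM
      have h₂ := x.cost_le hM
      nlinarith [Nat.zero_le (x.len * (b + 1))]
  | seq p q ihp ihq =>
    obtain ⟨K₁, h₁⟩ := ihp hp.1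
    obtain ⟨K₂, h₂⟩ := ihq hp.2
    refine ⟨K₁ + K₂ * (K₁ + 1), fun M b hM => ?_⟩
    obtain ⟨hb, t, ht, hr⟩ := h₁ M b hM
    obtain ⟨hb', t', ht', hr'⟩ := h₂ _ _ hb
    have hK : K₂ * (K₁ * (b + 1) + 1) ≤ K₂ * ((K₁ + 1) * (b + 1)) :=
      Nat.mul_le_mul_left _ (by nlinarith)
    refine ⟨fun a i => (hb' a i).trans ?_, t + t', ?_, .seq hr hr'⟩ <;>
      nlinarith [Nat.zero_le (K₁ * (b + 1))]
  | ite e p q ihp ihq =>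
    obtain ⟨K₁, h₁⟩ := ihp hp.1
    obtain ⟨K₂, h₂⟩ := ihq hp.2
    refine ⟨e.len ^ 2 + 1 + K₁ + K₂, fun M b hM => ?_⟩
    have he := e.cost_le hM
    have p₀ := Nat.zero_le (e.len ^ 2 * (b + 1))
    have p₁ := Nat.zero_le (K₁ * (b + 1))
    have p₂ := Nat.zero_le (K₂ * (b + 1))
    by_cases h : e.val M = 0
    · obtain ⟨hb, t, ht, hr⟩ := h₂ M b hM
      simp only [Cmd.exec, h, ne_eq, not_true_eq_false, if_false]
      exact ⟨fun a i => (hb a i).trans (by nlinarith), _, by nlinarith, .iteFalse h hr⟩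
    · obtain ⟨hb, t, ht, hr⟩ := h₁ M b hM
      simp only [Cmd.exec, h, ne_eq, not_false_eq_true, if_true]
      exact ⟨fun a i => (hb a i).trans (by nlinarith), _, by nlinarith, .iteTrue h hr⟩
  | loop e p _ => exact hp.elim

/-- `all n f` runs `f 0, …, f (n - 1)` one after the other. -/
def Cmd.all : ℕ → (ℕ → Cmd) → Cmd
  | 0, _ => .skip
  | n + 1, f => .seq (Cmd.all n f) (f n)

theorem Cmd.loopFree_all {f : ℕ → Cmd} (hf : ∀ i, (f i).LoopFree) (n : ℕ) :
    (Cmd.all n f).LoopFree := by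
  induction n with
  | zero => trivial
  | succ n ih => exact ⟨ih, hf n⟩

/-! ### Counting loops -/

/-- Runs `p` with cell `c` of array `7` counting from `0` to the content of cell `1` of array `0`
(the number of edges). -/
def Cmd.forLoop (c : ℕ) (p : Cmd) : Cmd :=
  .seq (.write 7 (.const c) (.const 0))
    (.loop (.sub (.read 0 (.const 1)) (.read 7 (.const c)))
      (.seq p (.write 7 (.const c) (.add (.read 7 (.const c)) (.const 1)))))

/-- The invariant rule for counting loops, with a time bound. -/
theorem run_forLoop {c m L T : ℕ} (hL : m ≤ L) {I : ℕ → Mem → Prop} {p : Cmd}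
    (hm : ∀ j M, I j M → M 0 1 = m)
    (hw : ∀ j M v, v ≤ m → I j M → I j (M.write 7 c v))
    (hstep : ∀ j < m, ∀ M, I j M → M 7 c = j →
      ∃ M' t, Run p M M' t ∧ t ≤ T ∧ I (j + 1) M' ∧ M' 7 c = j)
    {M : Mem} (hM : I 0 M) :
    ∃ M' t, Run (.forLoop c p) M M' t ∧ t ≤ (L + 1) * (T + 20 * (L + c + 1)) ∧ I m M' := by
  have hc := size_le_self c
  have h₁ : (1 : ℕ).size = 1 := by simp
  have h₀ : (0 : ℕ).size = 0 := by simp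
  have main : ∀ s j M, j + s = m → I j M → M 7 c = j →
      ∃ M' t, Run (.loop (.sub (.read 0 (.const 1)) (.read 7 (.const c)))
        (.seq p (.write 7 (.const c) (.add (.read 7 (.const c)) (.const 1))))) M M' t ∧
        t ≤ s * (T + 20 * (L + c + 1)) + 10 * (L + c + 1) ∧ I m M' := by
    intro s
    induction s with
    | zero =>
      intro j M hj hI hM
      obtain rfl : j = m := hj
      have hm' := hm _ _ hI
      have hs := size_le_self j
      refine ⟨M, _, .loopExit (by simp [Expr.val, hm', hM]), ?_, hI⟩
      simp only [Expr.cost, Expr.val, hm', hM, h₁, Nat.sub_self, h₀]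
      omega
    | succ s ih =>
      intro j M hj hI hM
      have hm' := hm _ _ hI
      obtain ⟨M₁, t₁, hr₁, ht₁, hI₁, hj₁⟩ := hstep j (by omega) M hI hM
      obtain ⟨M₂, t₂, hr₂, ht₂, hI₂⟩ := ih (j + 1) (M₁.write 7 c (j + 1)) (by omega)
        (hw _ _ _ (by omega) hI₁) (by simp [Mem.write_apply])
      have hw₁ := Run.write M₁ 7 (.const c) (.add (.read 7 (.const c)) (.const 1))
      simp only [Expr.val, hj₁] at hw₁
      refine ⟨M₂, _, .loopStep (by simp only [Expr.val, hm', hM]; omega) (.seq hr₁ hw₁) hr₂,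
        ?_, hI₂⟩
      have s₁ := size_le_self m
      have s₂ := size_le_self j
      have s₃ := size_le_self (j + 1)
      have s₄ := size_le_self (m - j)
      simp only [Expr.cost, Expr.val, hm', hM, hj₁, h₁]
      rw [Nat.succ_mul]
      omega
  obtain ⟨M', t, hr, ht, hI⟩ := main m 0 (M.write 7 c 0) (by omega) (hw _ _ _ (by omega) hM)
    (by simp [Mem.write_apply])
  refine ⟨M', _, .seq (.write M 7 (.const c) (.const 0)) hr, ?_, hI⟩
  have := Nat.mul_le_mul_right (T + 20 * (L + c + 1)) hL
  simp only [Expr.cost, h₀]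
  rw [Nat.succ_mul]
  omega

/-- `nest s p` runs `p` inside `s` nested counting loops with counters `s - 1, …, 0`. -/
def Cmd.nest : ℕ → Cmd → Cmd
  | 0, p => p
  | s + 1, p => .forLoop s (Cmd.nest s p)

/-- A time bound for `Cmd.nest s p`, where `p` takes time `T` and the loops run up to `L`. -/
def nestTime (L T : ℕ) : ℕ → ℕ
  | 0 => T
  | s + 1 => (L + 1) * (nestTime L T s + 20 * (L + s + 1))

/-- Nested loops visit every tuple of counter values: if the innermost program establishes `G b`
for the current tuple `b` of counters, and neither destroys `Inv` nor any earlier `G b`, then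
in the end `G b` holds for all tuples. -/
theorem run_nest {m L T r : ℕ} (hL : m ≤ L) {Inv : Mem → Prop} {G : (ℕ → ℕ) → Mem → Prop} {p : Cmd}
    (hm : ∀ M, Inv M → M 0 1 = m)
    (hw : ∀ M c v, v ≤ m → Inv M → Inv (M.write 7 c v))
    (hG : ∀ b M c v, G b M → G b (M.write 7 c v))
    (hp : ∀ M, Inv M → (∀ c < r, M 7 c < m) →
      ∃ M' t, Run p M M' t ∧ t ≤ T ∧ Inv M' ∧ M' 7 = M 7 ∧ (∀ b, G b M → G b M') ∧ G (M 7) M')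
    (s : ℕ) (hs : s ≤ r) (M : Mem) (hM : Inv M) (hc : ∀ c, s ≤ c → c < r → M 7 c < m) :
    ∃ M' t, Run (.nest s p) M M' t ∧ t ≤ nestTime L T s ∧ Inv M' ∧ (∀ c, s ≤ c → M' 7 c = M 7 c) ∧
      (∀ b, G b M → G b M') ∧
      ∀ b, (∀ c < s, b c < m) → (∀ c, s ≤ c → b c = M 7 c) → G b M' := by
  induction s generalizing M with
  | zero =>
    obtain ⟨M', t, hr, ht, hI, h7, hmono, hg⟩ := hp M hM fun c h => hc c (Nat.zero_le c) h
    refine ⟨M', t, hr, ht, hI, fun c _ => by rw [h7], hmono, fun b _ hb => ?_⟩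
    rwa [show b = M 7 from funext fun c => hb c (Nat.zero_le c)]
  | succ s ih =>
    have := run_forLoop (c := s) (T := nestTime L T s) hL (p := .nest s p) (M := M)
      (I := fun j M' => Inv M' ∧ (∀ c, s + 1 ≤ c → M' 7 c = M 7 c) ∧ (∀ b, G b M → G b M') ∧
        ∀ b, (∀ c < s, b c < m) → b s < j → (∀ c, s + 1 ≤ c → b c = M 7 c) → G b M')
      (fun j M' h => hm M' h.1) ?_ ?_ ?_
    · obtain ⟨M', t, hr, ht, hI, h7, hmono, hg⟩ := this
      exact ⟨M', t, hr, ht, hI, h7, hmono, fun b hb hb' =>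
        hg b (fun c h => hb c (by omega)) (hb s (by omega)) hb'⟩
    · rintro j M' v hv ⟨hI, h7, hmono, hg⟩
      refine ⟨hw _ _ _ hv hI, fun c h => ?_, fun b h => hG _ _ _ _ (hmono b h),
        fun b h₁ h₂ h₃ => hG _ _ _ _ (hg b h₁ h₂ h₃)⟩
      rw [Mem.write_apply, if_neg (by omega), h7 c h]
    · rintro j hj M₁ ⟨hI, h7, hmono, hg⟩ hs₁
      obtain ⟨M₂, t, hr, ht, hI₂, h7₂, hmono₂, hg₂⟩ := ih (by omega) M₁ hI (fun c h h' => by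
        rcases h.eq_or_lt with rfl | h
        · omega
        · rw [h7 c h]; exact hc c h h')
      refine ⟨M₂, t, hr, ht, ⟨hI₂, fun c h => ?_, fun b h => hmono₂ b (hmono b h), ?_⟩, ?_⟩
      · rw [h7₂ c (by omega), h7 c h]
      · intro b h₁ h₂ h₃
        rcases Nat.lt_succ_iff_lt_or_eq.1 h₂ with h₂ | h₂
        · exact hmono₂ b (hg b h₁ h₂ h₃)
        · refine hg₂ b h₁ fun c h => ?_
          rcases h.eq_or_lt with rfl | h
          · omega
          · rw [h₃ c h, h7 c h]
      · rw [h7₂ s le_rfl, hs₁]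
    · exact ⟨hM, fun _ _ => rfl, fun _ h => h, fun b _ h => absurd h (Nat.not_lt_zero _)⟩

/-! ### Polynomially bounded functions -/

/-- `f` is bounded by a polynomial with natural coefficients. -/
def PolyBounded (f : ℕ → ℕ) : Prop := ∃ p : Polynomial ℕ, ∀ L, f L ≤ p.eval L

namespace PolyBounded

theorem const (c : ℕ) : PolyBounded fun _ => c := ⟨.C c, by simp⟩

theorem id : PolyBounded fun L => L := ⟨.X, by simp⟩

theorem add {f g : ℕ → ℕ} (hf : PolyBounded f) (hg : PolyBounded g) :
    PolyBounded fun L => f L + g L := by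
  obtain ⟨p, hp⟩ := hf
  obtain ⟨q, hq⟩ := hg
  exact ⟨p + q, fun L => by rw [Polynomial.eval_add]; exact Nat.add_le_add (hp L) (hq L)⟩

theorem mul {f g : ℕ → ℕ} (hf : PolyBounded f) (hg : PolyBounded g) :
    PolyBounded fun L => f L * g L := by
  obtain ⟨p, hp⟩ := hf
  obtain ⟨q, hq⟩ := hg
  exact ⟨p * q, fun L => by rw [Polynomial.eval_mul]; exact Nat.mul_le_mul (hp L) (hq L)⟩

theorem nestTime {f : ℕ → ℕ} (hf : PolyBounded f) (s : ℕ) :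
    PolyBounded fun L => nestTime L (f L) s := by
  induction s with
  | zero => exact hf
  | succ s ih =>
    exact (id.add (const 1)).mul (ih.add ((const 20).mul ((id.add (const s)).add (const 1))))

end PolyBounded

/-! ### Arithmetic of fractions on the machine -/

/-- A fraction of two expressions. -/
structure FracExpr where
  num : Expr
  den : Expr

namespace FracExpr

/-- The value of a fraction, as a real number. -/
noncomputable def val (M : Mem) (e : FracExpr) : ℝ := (e.num.val M : ℝ) / (e.den.val M : ℝ)

def const (q : ℚ≥0) : FracExpr := ⟨.const q.num, .const q.den⟩

def add (e f : FracExpr) : FracExpr :=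
  ⟨.add (.mul e.num f.den) (.mul f.num e.den), .mul e.den f.den⟩

/-- The difference, truncated at zero like the subtraction of the machine. -/
def sub (e f : FracExpr) : FracExpr :=
  ⟨.sub (.mul e.num f.den) (.mul f.num e.den), .mul e.den f.den⟩

def mul (e f : FracExpr) : FracExpr := ⟨.mul e.num f.num, .mul e.den f.den⟩

def sum : ℕ → (ℕ → FracExpr) → FracExpr
  | 0, _ => const 0
  | n + 1, f => add (sum n f) (f n)

/-- The condition `e ≤ f`. -/
def le (e f : FracExpr) : Expr := .sub (.const 1) (.sub (.mul e.num f.den) (.mul f.num e.den))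

variable {M : Mem} {e f : FracExpr}

theorem val_const (q : ℚ≥0) : (const q).val M = (q : ℝ) := by
  simp only [val, const, Expr.val]
  conv_rhs => rw [← q.num_div_den]
  push_cast
  rfl

theorem den_const (q : ℚ≥0) : (const q).den.val M ≠ 0 := q.den_ne_zero

theorem val_mul : (mul e f).val M = e.val M * f.val M := by
  simp only [val, mul, Expr.val, Nat.cast_mul]
  exact (div_mul_div_comm _ _ _ _).symm

theorem den_mul (he : e.den.val M ≠ 0) (hf : f.den.val M ≠ 0) : (mul e f).den.val M ≠ 0 :=
  mul_ne_zero he hf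

theorem val_add (he : e.den.val M ≠ 0) (hf : f.den.val M ≠ 0) :
    (add e f).val M = e.val M + f.val M := by
  have he : (e.den.val M : ℝ) ≠ 0 := mod_cast he
  have hf : (f.den.val M : ℝ) ≠ 0 := mod_cast hf
  simp only [val, add, Expr.val, Nat.cast_mul, Nat.cast_add]
  field_simp

theorem den_add (he : e.den.val M ≠ 0) (hf : f.den.val M ≠ 0) : (add e f).den.val M ≠ 0 :=
  mul_ne_zero he hf

theorem val_le_val (he : e.den.val M ≠ 0) (hf : f.den.val M ≠ 0) :
    e.val M ≤ f.val M ↔ e.num.val M * f.den.val M ≤ f.num.val M * e.den.val M := by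
  have he : 0 < (e.den.val M : ℝ) := mod_cast Nat.pos_of_ne_zero he
  have hf : 0 < (f.den.val M : ℝ) := mod_cast Nat.pos_of_ne_zero hf
  rw [val, val, div_le_div_iff₀ he hf]
  exact_mod_cast Iff.rfl

theorem val_sub (he : e.den.val M ≠ 0) (hf : f.den.val M ≠ 0) (h : f.val M ≤ e.val M) :
    (sub e f).val M = e.val M - f.val M := by
  have h' := (val_le_val hf he).1 h
  have he : (e.den.val M : ℝ) ≠ 0 := mod_cast he
  have hf : (f.den.val M : ℝ) ≠ 0 := mod_cast hf
  simp only [val, sub, Expr.val]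
  rw [Nat.cast_sub h']
  push_cast
  field_simp

theorem den_sub (he : e.den.val M ≠ 0) (hf : f.den.val M ≠ 0) : (sub e f).den.val M ≠ 0 :=
  mul_ne_zero he hf

theorem sum_spec {f : ℕ → FracExpr} {n : ℕ} (h : ∀ i < n, (f i).den.val M ≠ 0) :
    (sum n f).den.val M ≠ 0 ∧ (sum n f).val M = ∑ i ∈ Finset.range n, (f i).val M := by
  induction n with
  | zero => exact ⟨den_const 0, by simp [sum, val_const]⟩
  | succ n ih =>
    obtain ⟨h₁, h₂⟩ := ih fun i hi => h i (by omega)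
    have h₃ := h n (by omega)
    exact ⟨den_add h₁ h₃, by rw [sum, val_add h₁ h₃, h₂, Finset.sum_range_succ]⟩

theorem le_val (he : e.den.val M ≠ 0) (hf : f.den.val M ≠ 0) :
    (le e f).val M ≠ 0 ↔ e.val M ≤ f.val M := by
  rw [val_le_val he hf]
  simp only [le, Expr.val]
  omega

/-- The sum of fractions depends only on the values of their parts. -/
theorem sum_congr {M' : Mem} {f : ℕ → FracExpr} (n : ℕ)
    (h : ∀ i, (f i).num.val M' = (f i).num.val M ∧ (f i).den.val M' = (f i).den.val M) :
    (sum n f).num.val M' = (sum n f).num.val M ∧ (sum n f).den.val M' = (sum n f).den.val M := by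
  induction n with
  | zero => exact ⟨rfl, rfl⟩
  | succ n ih => simp [sum, add, Expr.val, ih.1, ih.2, (h n).1, (h n).2]

end FracExpr

/-! ### The program

Array `0` holds the input. Array `1` marks the edges that are kept, array `2` the edges that belong
to a block. The total weight of objective `i` is the fraction of cells `i` of arrays `3` and `4`,
its potential that of cells `i` of arrays `5` and `6`. Array `7` holds the loop counters, which are
the indices of the edges of the candidate for a block. -/

/-- The number at offset `o` in the record of the edge whose index is counter `c`. -/
def entry (k c o : ℕ) : Expr :=
  .read 0 (.add (.mul (.const (2 * k + 2)) (.read 7 (.const c))) (.const (2 + o)))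

/-- The weight, relative to the total weight, of the edge whose index is counter `c`. The numerator
of the total weight is replaced by `1` if it is zero, so that the denominator is nonzero. -/
def relWeight (k i c : ℕ) : FracExpr :=
  ⟨.mul (entry k c (2 + 2 * i)) (.read 4 (.const i)),
    .mul (entry k c (3 + 2 * i))
      (.add (.read 3 (.const i)) (.sub (.const 1) (.read 3 (.const i))))⟩

/-- The factor `1 + lam (y_d - (y_0 + ⋯ + y_{r-1}) / r)` by which the potential of objective `i`
changes if edge `d` of a block with relative weights `y_0, …, y_{r-1}` is dropped. -/
def factor (k r : ℕ) (lam : ℚ≥0) (i d : ℕ) : FracExpr :=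
  .sub (.add (.const 1) (.mul (.const lam) (relWeight k i d)))
    (.mul (.const (lam / r)) (.sum r (relWeight k i)))

/-- The potential of objective `i`. -/
def pot (i : ℕ) : FracExpr := ⟨.read 5 (.const i), .read 6 (.const i)⟩

/-- Makes the current tuple of edges a block, of which edge `d` is dropped. -/
def dropCmd (k r : ℕ) (lam : ℚ≥0) (d : ℕ) : Cmd :=
  .seq (.write 1 (.read 7 (.const d)) (.const 0))
    (.seq (.all r fun c => .write 2 (.read 7 (.const c)) (.const 1))
      (.all k fun i =>
        .seq (.write 5 (.const i) (.mul (.read 5 (.const i)) (factor k r lam i d).num))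
          (.write 6 (.const i) (.mul (.read 6 (.const i)) (factor k r lam i d).den))))

/-- Dropping edge `d` does not increase the sum of the potentials. -/
def goodChoice (k r : ℕ) (lam : ℚ≥0) (d : ℕ) : Expr :=
  FracExpr.le (.sum k fun i => .mul (pot i) (factor k r lam i d)) (.sum k pot)

/-- Drops some edge `d < s` for which `goodChoice` holds, if there is one. -/
def chooseCmd (k r : ℕ) (lam : ℚ≥0) : ℕ → Cmd
  | 0 => .skip
  | s + 1 => .ite (goodChoice k r lam s) (dropCmd k r lam s) (chooseCmd k r lam s)

/-- None of the first `s` edges of the current tuple belongs to a block yet. -/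
def unusedExpr : ℕ → Expr
  | 0 => .const 1
  | s + 1 => .mul (unusedExpr s) (.sub (.const 1) (.read 2 (.read 7 (.const s))))

/-- Treats the current tuple of edges. The condition `adj` says which tuples may be blocks. -/
def blockCmd (k r : ℕ) (lam : ℚ≥0) (adj : Expr) : Cmd :=
  .ite (.mul adj (unusedExpr r)) (chooseCmd k r lam r) .skip

/-- Starts all totals with `0 / 1` and all potentials with `1 / 1`. -/
def initCmd (k : ℕ) : Cmd :=
  .all k fun i => .seq (.write 4 (.const i) (.const 1))
    (.seq (.write 5 (.const i) (.const 1)) (.write 6 (.const i) (.const 1)))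

/-- Marks the current edge as kept and adds its weights to the totals. -/
def tallyCmd (k : ℕ) : Cmd :=
  .seq (.write 1 (.read 7 (.const 0)) (.const 1))
    (.all k fun i =>
      .seq (.write 3 (.const i) (.add (.mul (.read 3 (.const i)) (entry k 0 (3 + 2 * i)))
          (.mul (entry k 0 (2 + 2 * i)) (.read 4 (.const i)))))
        (.write 4 (.const i) (.mul (.read 4 (.const i)) (entry k 0 (3 + 2 * i)))))

/-- Decomposes a cycle cover by dropping one edge from each of a maximal set of disjoint blocks. -/
def decomposeCmd (k r : ℕ) (lam : ℚ≥0) (adj : Expr) : Cmd :=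
  .seq (initCmd k) (.seq (.forLoop 0 (tallyCmd k)) (.nest r (blockCmd k r lam adj)))

theorem loopFree_dropCmd (k r : ℕ) (lam : ℚ≥0) (d : ℕ) : (dropCmd k r lam d).LoopFree := by
  refine ⟨trivial, Cmd.loopFree_all (fun _ => ?_) r, Cmd.loopFree_all (fun _ => ?_) k⟩ <;>
    simp [Cmd.LoopFree]

theorem loopFree_blockCmd (k r : ℕ) (lam : ℚ≥0) (adj : Expr) :
    (blockCmd k r lam adj).LoopFree := by
  have : ∀ s, (chooseCmd k r lam s).LoopFree := by
    intro s
    induction s with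
    | zero => trivial
    | succ s ih => exact ⟨loopFree_dropCmd k r lam s, ih⟩
  exact ⟨this r, trivial⟩

theorem loopFree_initCmd (k : ℕ) : (initCmd k).LoopFree :=
  Cmd.loopFree_all (fun _ => by simp [Cmd.LoopFree]) k

theorem loopFree_tallyCmd (k : ℕ) : (tallyCmd k).LoopFree :=
  ⟨trivial, Cmd.loopFree_all (fun _ => by simp [Cmd.LoopFree]) k⟩

/-! ### What the loop-free parts of the program compute -/

/-- The number at offset `o` in the record of edge `j` of the input word `x`. -/
def field (k : ℕ) (x : List ℕ) (j o : ℕ) : ℕ := x.getD ((2 * k + 2) * j + (2 + o)) 0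

/-- The weight of edge `j` of the input word `x` with respect to objective `i`. -/
noncomputable def wt (k : ℕ) (x : List ℕ) (i j : ℕ) : ℝ :=
  (field k x j (2 + 2 * i) : ℝ) / (field k x j (3 + 2 * i) : ℝ)

theorem entry_val {M : Mem} {x : List ℕ} (hM : M 0 = fun i => x.getD i 0) (k c o : ℕ) :
    (entry k c o).val M = field k x (M 7 c) o := by
  simp [entry, Expr.val, field, hM]

/-- The quotient of weight and total is computed correctly. If the total is zero, then so are the
weights, and both sides are zero. -/
theorem relWeight_spec {M : Mem} {x : List ℕ} {k i c : ℕ} {W : ℝ}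
    (hM : M 0 = fun i => x.getD i 0) (h₄ : M 4 i ≠ 0) (hW : (M 3 i : ℝ) / (M 4 i : ℝ) = W)
    (hd : field k x (M 7 c) (3 + 2 * i) ≠ 0) (h₀ : W = 0 → wt k x i (M 7 c) = 0) :
    (relWeight k i c).den.val M ≠ 0 ∧ (relWeight k i c).val M = wt k x i (M 7 c) / W := by
  simp only [relWeight, FracExpr.val, Expr.val, entry_val hM]
  refine ⟨mul_ne_zero hd (by omega), ?_⟩
  have h₄' : (M 4 i : ℝ) ≠ 0 := mod_cast h₄
  have hd' : (field k x (M 7 c) (3 + 2 * i) : ℝ) ≠ 0 := mod_cast hd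
  by_cases h₃ : M 3 i = 0
  · have hW₀ : W = 0 := by rw [← hW, h₃]; simp
    have := h₀ hW₀
    rw [wt, div_eq_zero_iff, or_iff_left hd'] at this
    simp [hW₀, this]
  · have h₃' : (M 3 i : ℝ) ≠ 0 := mod_cast h₃
    rw [show 1 - M 3 i = 0 by omega, wt, ← hW]
    push_cast
    field_simp
    simp

/-- The factor depends only on the input, the totals and the counters. -/
theorem factor_congr {M M' : Mem} (h₀ : M' 0 = M 0) (h₃ : M' 3 = M 3) (h₄ : M' 4 = M 4)
    (h₇ : M' 7 = M 7) (k r : ℕ) (lam : ℚ≥0) (i d : ℕ) :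
    (factor k r lam i d).num.val M' = (factor k r lam i d).num.val M ∧
      (factor k r lam i d).den.val M' = (factor k r lam i d).den.val M := by
  have hrel : ∀ c, (relWeight k i c).num.val M' = (relWeight k i c).num.val M ∧
      (relWeight k i c).den.val M' = (relWeight k i c).den.val M := fun c => by
    simp [relWeight, entry, Expr.val, h₀, h₃, h₄, h₇]
  obtain ⟨hs, hs'⟩ := FracExpr.sum_congr (M := M) (M' := M') r hrel
  simp [factor, FracExpr.sub, FracExpr.add, FracExpr.mul, FracExpr.const, Expr.val, hs, hs',
    (hrel d).1, (hrel d).2]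

theorem factor_spec {M : Mem} {k r i d : ℕ} {lam : ℚ≥0} {y : ℕ → ℝ} (hd : d < r)
    (hy : ∀ c < r, (relWeight k i c).den.val M ≠ 0 ∧ (relWeight k i c).val M = y c)
    (h : 0 ≤ 1 + (lam : ℝ) * (y d - (∑ c ∈ Finset.range r, y c) / r)) :
    (factor k r lam i d).den.val M ≠ 0 ∧
      (factor k r lam i d).val M = 1 + (lam : ℝ) * (y d - (∑ c ∈ Finset.range r, y c) / r) := by
  obtain ⟨hs, hs'⟩ := FracExpr.sum_spec (M := M) (f := relWeight k i) fun c hc => (hy c hc).1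
  rw [Finset.sum_congr rfl fun c hc => (hy c (Finset.mem_range.1 hc)).2] at hs'
  have h₁ : (FracExpr.mul (.const lam) (relWeight k i d)).den.val M ≠ 0 :=
    FracExpr.den_mul (FracExpr.den_const _) (hy d hd).1
  have h₂ : (FracExpr.mul (.const (lam / r)) (.sum r (relWeight k i))).den.val M ≠ 0 :=
    FracExpr.den_mul (FracExpr.den_const _) hs
  have h₃ := FracExpr.den_add (FracExpr.den_const (M := M) 1) h₁
  have h₄ : ((lam / r : ℚ≥0) : ℝ) = (lam : ℝ) / r := by push_cast; rfl
  refine ⟨FracExpr.den_sub h₃ h₂, ?_⟩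
  have e₁ := FracExpr.val_add (FracExpr.den_const (M := M) 1) h₁
  have e₂ : (FracExpr.mul (.const (lam / r)) (.sum r (relWeight k i))).val M
      = (lam : ℝ) / r * ∑ c ∈ Finset.range r, y c := by
    rw [FracExpr.val_mul, FracExpr.val_const, hs', h₄]
  rw [FracExpr.val_mul, FracExpr.val_const, FracExpr.val_const, (hy d hd).2] at e₁
  have e₃ : (1 : ℝ) + lam * (y d - (∑ c ∈ Finset.range r, y c) / r)
      = ((1 : ℚ≥0) : ℝ) + lam * y d - (lam : ℝ) / r * ∑ c ∈ Finset.range r, y c := by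
    push_cast; ring
  rw [factor, FracExpr.val_sub h₃ h₂ (by rw [e₁, e₂]; linarith), e₁, e₂, e₃]

theorem exec_initCmd (k : ℕ) (M : Mem) (a j : ℕ) :
    (initCmd k).exec M a j = if (a = 4 ∨ a = 5 ∨ a = 6) ∧ j < k then 1 else M a j := by
  unfold initCmd
  induction k with
  | zero => simp [Cmd.all, Cmd.exec]
  | succ k ih =>
    simp only [Cmd.all, Cmd.exec, Mem.write_apply, ih, Expr.val]
    grind

theorem exec_tallyCmd (k : ℕ) {x : List ℕ} {M : Mem} (hM : M 0 = fun i => x.getD i 0) (a j : ℕ) :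
    (tallyCmd k).exec M a j =
      if a = 1 ∧ j = M 7 0 then 1
      else if a = 3 ∧ j < k then M 3 j * field k x (M 7 0) (3 + 2 * j)
        + field k x (M 7 0) (2 + 2 * j) * M 4 j
      else if a = 4 ∧ j < k then M 4 j * field k x (M 7 0) (3 + 2 * j)
      else M a j := by
  have main : ∀ (n : ℕ) (M : Mem), M 0 = (fun i => x.getD i 0) → ∀ a j,
      (Cmd.all n fun i =>
        .seq (.write 3 (.const i) (.add (.mul (.read 3 (.const i)) (entry k 0 (3 + 2 * i)))
            (.mul (entry k 0 (2 + 2 * i)) (.read 4 (.const i)))))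
          (.write 4 (.const i) (.mul (.read 4 (.const i)) (entry k 0 (3 + 2 * i))))).exec M a j =
        if a = 3 ∧ j < n then M 3 j * field k x (M 7 0) (3 + 2 * j)
          + field k x (M 7 0) (2 + 2 * j) * M 4 j
        else if a = 4 ∧ j < n then M 4 j * field k x (M 7 0) (3 + 2 * j) else M a j := by
    intro n M hM
    induction n with
    | zero => simp [Cmd.all, Cmd.exec]
    | succ n ih =>
      intro a j
      set M₁ := (Cmd.all n _).exec M with hM₁
      have e₀ : M₁ 0 = fun i => x.getD i 0 := by
        rw [← hM]; funext i; rw [ih]; simp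
      have e₇ : M₁ 7 0 = M 7 0 := by rw [ih]; simp
      have e₀' : ∀ v w, Mem.write M₁ 3 v w 0 = fun i => x.getD i 0 := fun v w => by
        rw [← e₀]; funext i; simp [Mem.write_apply]
      simp only [Cmd.all, Cmd.exec, ← hM₁, Expr.val, entry_val e₀, entry_val (e₀' _ _), e₇,
        Mem.write_apply, ih]
      grind
  unfold tallyCmd
  rw [Cmd.exec, Cmd.exec, main k _ (by rw [← hM]; funext i; simp [Mem.write_apply])]
  simp only [Mem.write_apply, Expr.val]
  grind

theorem exec_dropCmd (k r : ℕ) (lam : ℚ≥0) (d : ℕ) (M : Mem) (a j : ℕ) :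
    (dropCmd k r lam d).exec M a j =
      if a = 1 ∧ j = M 7 d then 0
      else if a = 2 ∧ ∃ c < r, M 7 c = j then 1
      else if a = 5 ∧ j < k then M 5 j * (factor k r lam j d).num.val M
      else if a = 6 ∧ j < k then M 6 j * (factor k r lam j d).den.val M
      else M a j := by
  have h₂ : ∀ (n : ℕ) (M : Mem) (a j : ℕ),
      (Cmd.all n fun c => .write 2 (.read 7 (.const c)) (.const 1)).exec M a j =
        if a = 2 ∧ ∃ c < n, M 7 c = j then 1 else M a j := by
    intro n M
    induction n with
    | zero => simp [Cmd.all, Cmd.exec]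
    | succ n ih =>
      intro a j
      simp only [Cmd.all, Cmd.exec, Expr.val, Mem.write_apply, ih, Nat.exists_lt_succ_right]
      by_cases q : ∃ c < n, M 7 c = j <;> simp only [q] <;> grind
  have h₅ : ∀ (n : ℕ) (M : Mem) (a j : ℕ),
      (Cmd.all n fun i =>
        .seq (.write 5 (.const i) (.mul (.read 5 (.const i)) (factor k r lam i d).num))
          (.write 6 (.const i) (.mul (.read 6 (.const i)) (factor k r lam i d).den))).exec M a j =
        if a = 5 ∧ j < n then M 5 j * (factor k r lam j d).num.val M
        else if a = 6 ∧ j < n then M 6 j * (factor k r lam j d).den.val M else M a j := by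
    intro n M
    induction n with
    | zero => simp [Cmd.all, Cmd.exec]
    | succ n ih =>
      intro a j
      set M₁ := (Cmd.all n _).exec M with hM₁
      have e : ∀ b, b ≠ 5 → b ≠ 6 → M₁ b = M b := fun b h h' => by
        funext i; rw [ih]; simp [h, h']
      have e' : ∀ b v w, b ≠ 5 → b ≠ 6 → Mem.write M₁ 5 v w b = M b := fun b v w h h' => by
        rw [← e b h h']; funext i; simp [Mem.write_apply, h]
      have c₁ := (factor_congr (M := M) (M' := M₁) (e 0 (by simp) (by simp))
        (e 3 (by simp) (by simp)) (e 4 (by simp) (by simp)) (e 7 (by simp) (by simp)) k r lam n d).1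
      have c₂ := fun v w => (factor_congr (M := M) (M' := Mem.write M₁ 5 v w)
        (e' 0 _ _ (by simp) (by simp)) (e' 3 _ _ (by simp) (by simp))
        (e' 4 _ _ (by simp) (by simp)) (e' 7 _ _ (by simp) (by simp)) k r lam n d).2
      simp only [Cmd.all, Cmd.exec, ← hM₁, Expr.val, c₁, c₂, Mem.write_apply, ih]
      grind
  change (Cmd.all k _).exec ((Cmd.all r _).exec (Cmd.exec (.write 1 _ _) M)) a j = _
  rw [h₅]
  set M₁ : Mem := (Cmd.write 1 (.read 7 (.const d)) (.const 0)).exec M with hM₁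
  have e₁ : ∀ b, b ≠ 1 → M₁ b = M b := fun b h => by
    funext i; simp [hM₁, Cmd.exec, Mem.write_apply, h]
  set M₂ : Mem := (Cmd.all r _).exec M₁ with hM₂
  have e₂ : ∀ b, b ≠ 1 → b ≠ 2 → M₂ b = M b := fun b h h' => by
    funext i; rw [hM₂, h₂, if_neg (by simp [h']), e₁ b h]
  have c := factor_congr (M := M) (M' := M₂) (e₂ 0 (by simp) (by simp)) (e₂ 3 (by simp) (by simp))
    (e₂ 4 (by simp) (by simp)) (e₂ 7 (by simp) (by simp)) k r lam j d
  rw [c.1, c.2, e₂ 5 (by simp) (by simp), e₂ 6 (by simp) (by simp), hM₂, h₂, e₁ 7 (by simp)]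
  have : M₁ a j = if a = 1 ∧ j = M 7 d then 0 else M a j := by
    simp [hM₁, Cmd.exec, Mem.write_apply, Expr.val]
  rw [this]
  clear * -
  split_ifs <;> first | rfl | simp_all

theorem exec_chooseCmd {k r : ℕ} {lam : ℚ≥0} {M : Mem} (s : ℕ)
    (h : ∃ d < s, (goodChoice k r lam d).val M ≠ 0) :
    ∃ d < s, (goodChoice k r lam d).val M ≠ 0 ∧
      (chooseCmd k r lam s).exec M = (dropCmd k r lam d).exec M := by
  induction s with
  | zero => obtain ⟨d, hd, _⟩ := h; omega
  | succ s ih =>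
    simp only [chooseCmd, Cmd.exec]
    by_cases hs : (goodChoice k r lam s).val M ≠ 0
    · exact ⟨s, by omega, hs, if_pos hs⟩
    · obtain ⟨d, hd, hg⟩ := h
      obtain ⟨d, hd, hg, he⟩ := ih ⟨d, (Nat.lt_succ_iff_lt_or_eq.1 hd).resolve_right
        (fun h => hs (h ▸ hg)), hg⟩
      exact ⟨d, by omega, hg, by rw [if_neg hs, he]⟩

theorem unusedExpr_val (M : Mem) (s : ℕ) :
    (unusedExpr s).val M ≠ 0 ↔ ∀ c < s, M 2 (M 7 c) = 0 := by
  induction s with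
  | zero => simp [unusedExpr, Expr.val]
  | succ s ih =>
    rw [unusedExpr, Expr.val, mul_ne_zero_iff, ih]
    simp only [Expr.val, Nat.lt_succ_iff_lt_or_eq]
    grind

/-! ### The potential: inequalities -/

theorem exp_sub_sq_le {z : ℝ} (hz : -(1 / 2) ≤ z) : Real.exp (z - z ^ 2) ≤ 1 + z := by
  rcases le_or_gt 0 z with h | h
  · have h₁ := Real.add_one_le_exp (-(z - z ^ 2))
    have h₂ : Real.exp (z - z ^ 2) * Real.exp (-(z - z ^ 2)) = 1 := by
      rw [← Real.exp_add]; simp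
    have h₃ := Real.exp_pos (z - z ^ 2)
    have h₄ : 0 < 1 - z + z ^ 2 := by nlinarith [sq_nonneg (z - 1)]
    have h₅ : Real.exp (z - z ^ 2) * (1 - z + z ^ 2) ≤ (1 + z) * (1 - z + z ^ 2) := by
      have : Real.exp (z - z ^ 2) * (1 - z + z ^ 2) ≤ 1 := by
        rw [← h₂]; exact mul_le_mul_of_nonneg_left (by linarith) h₃.le
      nlinarith [pow_nonneg h 3]
    exact le_of_mul_le_mul_right h₅ h₄
  · have hu : 0 ≤ z ^ 2 - z := by nlinarith
    have h₁ := Real.quadratic_le_exp_of_nonneg hu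
    have h₂ : Real.exp (z - z ^ 2) * Real.exp (z ^ 2 - z) = 1 := by
      rw [← Real.exp_add]; simp
    have h₃ := Real.exp_pos (z ^ 2 - z)
    have h₄ : 1 ≤ (1 + z) * (1 + (z ^ 2 - z) + (z ^ 2 - z) ^ 2 / 2) := by
      have h₅ : 0 ≤ (1 + z) * (1 - z) ^ 2 / 2 + z := by nlinarith [sq_nonneg z]
      nlinarith [mul_nonneg (sq_nonneg z) h₅]
    refine le_of_mul_le_mul_right ?_ h₃
    rw [h₂]
    exact h₄.trans (mul_le_mul_of_nonneg_left h₁ (by linarith))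

/-- In a block of two or three numbers in `[0, η]`, the square of the deviation of one number from
the average is at most `4/9 * η` times the sum of the block. -/
theorem block_deviation {r d : ℕ} {y : ℕ → ℝ} {η : ℝ} (hr : r = 2 ∨ r = 3) (hd : d < r)
    (h₀ : ∀ c < r, 0 ≤ y c) (h₁ : ∀ c < r, y c ≤ η) :
    -(2 / 3 * η) ≤ y d - (∑ c ∈ Finset.range r, y c) / r ∧
      (y d - (∑ c ∈ Finset.range r, y c) / r) ^ 2 ≤ 4 / 9 * η * ∑ c ∈ Finset.range r, y c := by
  have key : ∀ x S : ℝ, -(2 / 3 * η) ≤ x → x ≤ 2 / 3 * η → -(2 / 3 * S) ≤ x → x ≤ 2 / 3 * S →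
      -(2 / 3 * η) ≤ x ∧ x ^ 2 ≤ 4 / 9 * η * S := by
    intro x S a b c d
    refine ⟨a, ?_⟩
    have := mul_le_mul (abs_le.2 ⟨a, b⟩) (abs_le.2 ⟨c, d⟩) (abs_nonneg x) (by linarith)
    rw [abs_mul_abs_self] at this
    nlinarith
  rcases hr with rfl | rfl
  · have a₀ := h₀ 0 (by norm_num)
    have a₁ := h₀ 1 (by norm_num)
    have b₀ := h₁ 0 (by norm_num)
    have b₁ := h₁ 1 (by norm_num)
    apply key <;> interval_cases d <;> simp only [Finset.sum_range_succ, Finset.sum_range_zero] <;>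
      push_cast <;> linarith
  · have a₀ := h₀ 0 (by norm_num)
    have a₁ := h₀ 1 (by norm_num)
    have a₂ := h₀ 2 (by norm_num)
    have b₀ := h₁ 0 (by norm_num)
    have b₁ := h₁ 1 (by norm_num)
    have b₂ := h₁ 2 (by norm_num)
    apply key <;> interval_cases d <;> simp only [Finset.sum_range_succ, Finset.sum_range_zero] <;>
      push_cast <;> linarith

/-- The factor of the potential is at least `exp (lam * x - lam ^ 2 * v)`, where `x` is the loss
above average and `v` is a bound on the variance that adds up to at most `4/9 * η`. -/
theorem exp_le_factor {r d : ℕ} {y : ℕ → ℝ} {η lam : ℝ} (hr : r = 2 ∨ r = 3) (hd : d < r)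
    (hl : 0 ≤ lam) (hη : lam * η ≤ 3 / 4) (h₀ : ∀ c < r, 0 ≤ y c) (h₁ : ∀ c < r, y c ≤ η) :
    Real.exp (lam * (y d - (∑ c ∈ Finset.range r, y c) / r)
      - lam ^ 2 * (4 / 9 * η * ∑ c ∈ Finset.range r, y c))
      ≤ 1 + lam * (y d - (∑ c ∈ Finset.range r, y c) / r) := by
  obtain ⟨h₂, h₃⟩ := block_deviation hr hd h₀ h₁
  set x := y d - (∑ c ∈ Finset.range r, y c) / r
  refine le_trans (Real.exp_le_exp.2 ?_) (exp_sub_sq_le (z := lam * x) ?_)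
  · rw [mul_pow]
    linarith [mul_le_mul_of_nonneg_left h₃ (sq_nonneg lam)]
  · linarith [mul_le_mul_of_nonneg_left h₂ hl]

/-- A uniformly random choice in the block keeps the expected potential constant, so some choice
does not increase it. -/
theorem exists_choice {k r : ℕ} (hr : 0 < r) (Φ : ℕ → ℝ) (lam : ℝ) (y : ℕ → ℕ → ℝ) :
    ∃ d < r, ∑ i ∈ Finset.range k,
      Φ i * (1 + lam * (y i d - (∑ c ∈ Finset.range r, y i c) / r)) ≤
        ∑ i ∈ Finset.range k, Φ i := by
  have hr' : (r : ℝ) ≠ 0 := by positivity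
  obtain ⟨d, hd, h⟩ := Finset.exists_le_of_sum_le (s := Finset.range r)
    (f := fun d => ∑ i ∈ Finset.range k,
      Φ i * (1 + lam * (y i d - (∑ c ∈ Finset.range r, y i c) / r)))
    (g := fun _ => ∑ i ∈ Finset.range k, Φ i) ⟨0, Finset.mem_range.2 hr⟩ (by
      rw [Finset.sum_comm, Finset.sum_comm (s := Finset.range r)]
      refine Finset.sum_le_sum fun i _ => ?_
      rw [← Finset.mul_sum, Finset.sum_add_distrib, ← Finset.mul_sum, Finset.sum_sub_distrib]
      simp only [Finset.sum_const, Finset.card_range, nsmul_eq_mul, mul_one]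
      rw [mul_div_cancel₀ _ hr', sub_self, mul_zero, add_zero, mul_comm])
  exact ⟨d, Finset.mem_range.1 hd, h⟩

/-! ### The invariant of the main loops -/

/-- The number of edges of the input word `x`. -/
def numEdges (x : List ℕ) : ℕ := x.getD 1 0

/-- The total weight of all edges of `x` with respect to objective `i`. -/
noncomputable def totalWt (k : ℕ) (x : List ℕ) (i : ℕ) : ℝ :=
  ∑ j ∈ Finset.range (numEdges x), wt k x i j

/-- The weight of edge `j` as a fraction of the total weight. -/
noncomputable def relWt (k : ℕ) (x : List ℕ) (i j : ℕ) : ℝ := wt k x i j / totalWt k x i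

/-- The edges that are not marked as kept. -/
def dropped (x : List ℕ) (M : Mem) : Finset ℕ := (Finset.range (numEdges x)).filter (M 1 · = 0)

/-- The edges that belong to a block formed so far. -/
def used (x : List ℕ) (M : Mem) : Finset ℕ := (Finset.range (numEdges x)).filter (M 2 · ≠ 0)

/-- The memory that consists only of the input word `x` and the tuple `b` of counters. -/
def blockMem (x : List ℕ) (b : ℕ → ℕ) : Mem :=
  fun a i => if a = 0 then x.getD i 0 else if a = 7 then b i else 0

/-- The tuple `b` of edges satisfies the condition `adj`. -/
def IsBlock (adj : Expr) (x : List ℕ) (b : ℕ → ℕ) : Prop := adj.val (blockMem x b) ≠ 0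

/-- The expression depends only on the input and the counters. -/
def ReadsInput (adj : Expr) : Prop :=
  ∀ M M' : Mem, M 0 = M' 0 → M 7 = M' 7 → adj.val M = adj.val M'

theorem ReadsInput.val_eq {adj : Expr} (h : ReadsInput adj) {x : List ℕ} {M : Mem}
    (hM : M 0 = fun i => x.getD i 0) : adj.val M ≠ 0 ↔ IsBlock adj x (M 7) := by
  rw [IsBlock, h M (blockMem x (M 7)) (by rw [hM]; rfl) rfl]

/-- The invariant of the loops over all tuples of edges. The field `potential` bounds the potential
of an objective from below by the exponential of the loss above average, minus a variance term;
`block` says that every edge that is used lies in a block with a dropped edge. The bit lengths of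
the totals are bounded by `B`, and those of the potentials grow by at most `Δ` with each edge that
is used. -/
structure Invariant (k r : ℕ) (lam : ℚ≥0) (adj : Expr) (η : ℝ) (x : List ℕ) (B Δ : ℕ) (M : Mem) :
    Prop where
  input : M 0 = fun i => x.getD i 0
  counter : ∀ c, M 7 c ≤ numEdges x
  other : ∀ a i, 8 ≤ a → M a i = 0
  flag : ∀ j, M 1 j ≤ 1
  mark : ∀ j, M 2 j ≤ 1
  size_num : ∀ i, (M 3 i).size ≤ B
  size_den : ∀ i, (M 4 i).size ≤ B
  total_den : ∀ i < k, M 4 i ≠ 0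
  total : ∀ i < k, (M 3 i : ℝ) / (M 4 i : ℝ) = totalWt k x i
  used_of_dropped : ∀ j < numEdges x, M 1 j = 0 → M 2 j ≠ 0
  block : ∀ j < numEdges x, M 2 j ≠ 0 → ∃ b : ℕ → ℕ, (∀ c < r, b c < numEdges x) ∧
    IsBlock adj x b ∧ (∃ c < r, b c = j) ∧ ∃ d < r, M 1 (b d) = 0
  pot_den : ∀ i < k, M 6 i ≠ 0
  potential : ∀ i < k, Real.exp ((lam : ℝ) * (∑ j ∈ dropped x M, relWt k x i j
      - (∑ j ∈ used x M, relWt k x i j) / r)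
      - (lam : ℝ) ^ 2 * (4 / 9 * η * ∑ j ∈ used x M, relWt k x i j)) ≤ (M 5 i : ℝ) / (M 6 i : ℝ)
  pot_sum : ∑ i ∈ Finset.range k, (M 5 i : ℝ) / (M 6 i : ℝ) ≤ k
  size_pot_num : ∀ i, (M 5 i).size ≤ 1 + (used x M).card * Δ
  size_pot_den : ∀ i, (M 6 i).size ≤ 1 + (used x M).card * Δ

/-- The input word `x` encodes fractions with nonzero denominators, and every edge has at most the
fraction `η` of the total weight of each objective. -/
structure LightWord (k : ℕ) (η : ℝ) (x : List ℕ) : Prop where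
  den_ne_zero : ∀ j < numEdges x, ∀ i < k, field k x j (3 + 2 * i) ≠ 0
  light : ∀ j < numEdges x, ∀ i < k, wt k x i j ≤ η * totalWt k x i

theorem wt_nonneg (k : ℕ) (x : List ℕ) (i j : ℕ) : 0 ≤ wt k x i j := by unfold wt; positivity

theorem totalWt_nonneg (k : ℕ) (x : List ℕ) (i : ℕ) : 0 ≤ totalWt k x i :=
  Finset.sum_nonneg fun j _ => wt_nonneg k x i j

theorem relWt_nonneg (k : ℕ) (x : List ℕ) (i j : ℕ) : 0 ≤ relWt k x i j :=
  div_nonneg (wt_nonneg k x i j) (totalWt_nonneg k x i)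

theorem wt_eq_zero {k : ℕ} {x : List ℕ} {i j : ℕ} (hj : j < numEdges x) (h : totalWt k x i = 0) :
    wt k x i j = 0 :=
  (Finset.sum_eq_zero_iff_of_nonneg fun j _ => wt_nonneg k x i j).1 h j (Finset.mem_range.2 hj)

theorem relWt_le {k : ℕ} {η : ℝ} {x : List ℕ} (hx : LightWord k η x) (hη : 0 ≤ η) {i j : ℕ}
    (hi : i < k) (hj : j < numEdges x) : relWt k x i j ≤ η := by
  rcases (totalWt_nonneg k x i).eq_or_lt with h | h
  · rw [relWt, ← h, div_zero]; exact hη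
  · rw [relWt, div_le_iff₀ h]; exact hx.light j hj i hi

theorem Invariant.write_counter {k r : ℕ} {lam : ℚ≥0} {adj : Expr} {η : ℝ} {x : List ℕ} {B Δ : ℕ}
    {M : Mem} (h : Invariant k r lam adj η x B Δ M) (c v : ℕ) (hv : v ≤ numEdges x) :
    Invariant k r lam adj η x B Δ (M.write 7 c v) := by
  have e : ∀ a, a ≠ 7 → M.write 7 c v a = M a := fun a ha => by
    funext i; simp [Mem.write_apply, ha]
  have e₁ := e 1 (by simp)
  have e₂ := e 2 (by simp)
  have hd : dropped x (M.write 7 c v) = dropped x M := by unfold dropped; rw [e₁]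
  have hu : used x (M.write 7 c v) = used x M := by unfold used; rw [e₂]
  constructor
  · rw [e 0 (by simp)]; exact h.input
  · intro c'
    rw [Mem.write_apply]
    split_ifs
    exacts [hv, h.counter c']
  · intro a i ha; rw [e a (by omega)]; exact h.other a i ha
  · rw [e₁]; exact h.flag
  · rw [e₂]; exact h.mark
  · rw [e 3 (by simp)]; exact h.size_num
  · rw [e 4 (by simp)]; exact h.size_den
  · rw [e 4 (by simp)]; exact h.total_den
  · rw [e 3 (by simp), e 4 (by simp)]; exact h.total
  · rw [e₁, e₂]; exact h.used_of_dropped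
  · rw [e₁, e₂]; exact h.block
  · rw [e 6 (by simp)]; exact h.pot_den
  · rw [hd, hu, e 5 (by simp), e 6 (by simp)]; exact h.potential
  · rw [e 5 (by simp), e 6 (by simp)]; exact h.pot_sum
  · rw [hu, e 5 (by simp)]; exact h.size_pot_num
  · rw [hu, e 6 (by simp)]; exact h.size_pot_den

theorem size_le_inputSize (x : List ℕ) (i : ℕ) : (x.getD i 0).size ≤ inputSize x := by
  induction x generalizing i with
  | nil => simp [inputSize]
  | cons a x ih =>
    rw [inputSize, List.map_cons, List.sum_cons]
    cases i with
    | zero => simp only [List.getD_cons_zero]; omega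
    | succ i => have := ih i; rw [inputSize] at this; simp only [List.getD_cons_succ]; omega

theorem length_le_inputSize (x : List ℕ) : x.length ≤ inputSize x := by
  induction x with
  | nil => simp
  | cons a x ih =>
    rw [inputSize] at *
    rw [List.map_cons, List.sum_cons, List.length_cons]; omega

theorem size_le_one {n : ℕ} (h : n ≤ 1) : n.size ≤ 1 := (size_le_self n).trans h

theorem Invariant.bounded {k r : ℕ} {lam : ℚ≥0} {adj : Expr} {η : ℝ} {x : List ℕ} {B Δ : ℕ}
    {M : Mem} (h : Invariant k r lam adj η x B Δ M) (hL : numEdges x ≤ inputSize x) :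
    M.Bounded (inputSize x + B + 1 + inputSize x * Δ) := by
  have hcard : (used x M).card * Δ ≤ inputSize x * Δ := by
    refine Nat.mul_le_mul_right _ (le_trans ?_ hL)
    exact (Finset.card_filter_le _ _).trans (by simp)
  intro a i
  by_cases ha : 8 ≤ a
  · simp [h.other a i ha]
  have := size_le_one (h.flag i)
  have := size_le_one (h.mark i)
  have := h.size_num i
  have := h.size_den i
  have := h.size_pot_num i
  have := h.size_pot_den i
  have := (size_le_self _).trans (h.counter i)
  have h0 : (M 0 i).size ≤ inputSize x := by rw [h.input]; exact size_le_inputSize x i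
  interval_cases a <;> omega

/-- The parts of the factors are short, since they depend only on input, totals and counters. -/
theorem Invariant.size_factor {k r : ℕ} {lam : ℚ≥0} {adj : Expr} {η : ℝ} {x : List ℕ} {B Δ : ℕ}
    {M : Mem} (h : Invariant k r lam adj η x B Δ M) (hL : numEdges x ≤ inputSize x) (i d : ℕ) :
    ((factor k r lam i d).num.val M).size
        ≤ (factor k r lam i d).num.len * (inputSize x + B + 1 + 1) ∧
      ((factor k r lam i d).den.val M).size
        ≤ (factor k r lam i d).den.len * (inputSize x + B + 1 + 1) := by
  set M' : Mem := fun a i => if a = 5 ∨ a = 6 then 0 else M a i with hM'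
  have hb : M'.Bounded (inputSize x + B + 1) := by
    intro a i
    by_cases ha : 8 ≤ a
    · simp [hM', h.other a i ha]
    have := size_le_one (h.flag i)
    have := size_le_one (h.mark i)
    have := h.size_num i
    have := h.size_den i
    have := (size_le_self _).trans (h.counter i)
    have h0 : (M 0 i).size ≤ inputSize x := by rw [h.input]; exact size_le_inputSize x i
    interval_cases a <;> simp [hM'] <;> omega
  obtain ⟨e₁, e₂⟩ := factor_congr (M := M) (M' := M') (by simp [hM']) (by simp [hM'])
    (by simp [hM']) (by simp [hM']) k r lam i d
  rw [← e₁, ← e₂]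
  exact ⟨Expr.size_val_le hb _, Expr.size_val_le hb _⟩

/-- Dropping an edge of a new block for which the potential does not increase. -/
theorem Invariant.drop {k r : ℕ} {lam : ℚ≥0} {adj : Expr} {η : ℝ} {x : List ℕ} {B Δ : ℕ}
    {M : Mem} (h : Invariant k r lam adj η x B Δ M) (hL : numEdges x ≤ inputSize x)
    (hr : r = 2 ∨ r = 3) (hη₀ : 0 ≤ η) (hη : (lam : ℝ) * η ≤ 3 / 4) (hx : LightWord k η x)
    (hΔ : ∀ i < k, ∀ d < r, (factor k r lam i d).num.len * (inputSize x + B + 1 + 1) ≤ Δ ∧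
      (factor k r lam i d).den.len * (inputSize x + B + 1 + 1) ≤ Δ)
    (hc : ∀ c < r, M 7 c < numEdges x) (hb : IsBlock adj x (M 7))
    (hinj : Set.InjOn (M 7) (Finset.range r)) (hun : ∀ c < r, M 2 (M 7 c) = 0)
    {d : ℕ} (hd : d < r) (hgood : ∑ i ∈ Finset.range k, (M 5 i : ℝ) / (M 6 i : ℝ) *
      (1 + (lam : ℝ) * (relWt k x i (M 7 d) - (∑ c ∈ Finset.range r, relWt k x i (M 7 c)) / r))
      ≤ ∑ i ∈ Finset.range k, (M 5 i : ℝ) / (M 6 i : ℝ))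
    (hfac : ∀ i < k, (factor k r lam i d).den.val M ≠ 0 ∧ (factor k r lam i d).val M =
      1 + (lam : ℝ) * (relWt k x i (M 7 d) - (∑ c ∈ Finset.range r, relWt k x i (M 7 c)) / r)) :
    Invariant k r lam adj η x B Δ ((dropCmd k r lam d).exec M) := by
  set M' := (dropCmd k r lam d).exec M with hM'
  have ex : ∀ a j, M' a j = _ := exec_dropCmd k r lam d M
  have e : ∀ a, a ≠ 1 → a ≠ 2 → a ≠ 5 → a ≠ 6 → M' a = M a := fun a h₁ h₂ h₅ h₆ => by
    funext j; rw [ex]; simp [h₁, h₂, h₅, h₆]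
  have e₀ := e 0 (by simp) (by simp) (by simp) (by simp)
  have e₃ := e 3 (by simp) (by simp) (by simp) (by simp)
  have e₄ := e 4 (by simp) (by simp) (by simp) (by simp)
  have e₇ := e 7 (by simp) (by simp) (by simp) (by simp)
  have e₁ : ∀ j, M' 1 j = if j = M 7 d then 0 else M 1 j := fun j => by rw [ex]; simp
  have e₂ : ∀ j, M' 2 j = if ∃ c < r, M 7 c = j then 1 else M 2 j := fun j => by rw [ex]; simp
  have e₅ : ∀ i, M' 5 i = if i < k then M 5 i * (factor k r lam i d).num.val M else M 5 i :=
    fun i => by rw [ex]; simp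
  have e₆ : ∀ i, M' 6 i = if i < k then M 6 i * (factor k r lam i d).den.val M else M 6 i :=
    fun i => by rw [ex]; simp
  have hused : used x M' = used x M ∪ (Finset.range r).image (M 7) := by
    ext j
    simp only [used, Finset.mem_filter, Finset.mem_range, Finset.mem_union, Finset.mem_image, e₂]
    constructor
    · rintro ⟨hj, hj'⟩
      split_ifs at hj' with hq
      exacts [Or.inr hq, Or.inl ⟨hj, hj'⟩]
    · rintro (⟨hj, hj'⟩ | hq)
      · exact ⟨hj, by split_ifs <;> simp [hj']⟩
      · obtain ⟨c, hcr, rfl⟩ := hq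
        exact ⟨hc c hcr, by rw [if_pos ⟨c, hcr, rfl⟩]; simp⟩
  have hdisj : Disjoint (used x M) ((Finset.range r).image (M 7)) := by
    rw [Finset.disjoint_right]
    intro j hj
    obtain ⟨c, hcr, rfl⟩ := Finset.mem_image.1 hj
    simp [used, hun c (Finset.mem_range.1 hcr)]
  have husum : ∀ i, ∑ j ∈ used x M', relWt k x i j = ∑ j ∈ used x M, relWt k x i j +
      ∑ c ∈ Finset.range r, relWt k x i (M 7 c) := fun i => by
    rw [hused, Finset.sum_union hdisj, Finset.sum_image hinj]
  have hcard : (used x M').card = (used x M).card + r := by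
    rw [hused, Finset.card_union_of_disjoint hdisj, Finset.card_image_of_injOn hinj,
      Finset.card_range]
  have hdrop : dropped x M' = insert (M 7 d) (dropped x M) := by
    ext j
    simp only [dropped, Finset.mem_filter, Finset.mem_range, Finset.mem_insert, e₁]
    constructor
    · rintro ⟨hj, hj'⟩
      split_ifs at hj' with hq
      exacts [Or.inl hq, Or.inr ⟨hj, hj'⟩]
    · rintro (rfl | ⟨hj, hj'⟩)
      · exact ⟨hc d hd, by simp⟩
      · exact ⟨hj, by simp [hj']⟩
  have hnd : M 7 d ∉ dropped x M := fun hmem => by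
    rw [dropped, Finset.mem_filter] at hmem
    exact h.used_of_dropped _ (hc d hd) hmem.2 (hun d hd)
  have hdsum : ∀ i, ∑ j ∈ dropped x M', relWt k x i j =
      relWt k x i (M 7 d) + ∑ j ∈ dropped x M, relWt k x i j := fun i => by
    rw [hdrop, Finset.sum_insert hnd]
  have hpot : ∀ i < k, (M' 5 i : ℝ) / (M' 6 i : ℝ) = (M 5 i : ℝ) / (M 6 i : ℝ) *
      (1 + (lam : ℝ) * (relWt k x i (M 7 d)
        - (∑ c ∈ Finset.range r, relWt k x i (M 7 c)) / r)) := fun i hi => by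
    rw [← (hfac i hi).2, e₅, e₆, if_pos hi, if_pos hi, FracExpr.val, div_mul_div_comm]
    push_cast
    rfl
  have hsize : ∀ v f : ℕ, v.size ≤ 1 + (used x M).card * Δ → f.size ≤ Δ →
      (v * f).size ≤ 1 + (used x M').card * Δ := by
    intro v f hv hf
    have h₁ := size_mul_le v f
    have h₂ : Δ ≤ r * Δ := Nat.le_mul_of_pos_left _ (by omega)
    rw [hcard, Nat.add_mul]
    omega
  constructor
  · rw [e₀]; exact h.input
  · rw [e₇]; exact h.counter
  · intro a i ha
    rw [e a (by omega) (by omega) (by omega) (by omega)]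
    exact h.other a i ha
  · intro j
    rw [e₁]
    split_ifs
    exacts [zero_le_one, h.flag j]
  · intro j
    rw [e₂]
    split_ifs
    exacts [le_rfl, h.mark j]
  · rw [e₃]; exact h.size_num
  · rw [e₄]; exact h.size_den
  · rw [e₄]; exact h.total_den
  · rw [e₃, e₄]; exact h.total
  · intro j hj hj'
    have : j ∈ dropped x M' := by simp [dropped, hj, hj']
    rw [hdrop, Finset.mem_insert] at this
    rw [e₂]
    rcases this with rfl | hmem
    · rw [if_pos ⟨d, hd, rfl⟩]; simp
    · rw [dropped, Finset.mem_filter] at hmem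
      split_ifs
      exacts [one_ne_zero, h.used_of_dropped j hj hmem.2]
  · intro j hj hj'
    rw [e₂] at hj'
    split_ifs at hj' with hq
    · exact ⟨M 7, hc, hb, hq, d, hd, by rw [e₁, if_pos rfl]⟩
    · obtain ⟨b, h₁, h₂, h₃, d', hd', h₄⟩ := h.block j hj hj'
      exact ⟨b, h₁, h₂, h₃, d', hd', by rw [e₁]; split_ifs; exacts [rfl, h₄]⟩
  · intro i hi
    rw [e₆, if_pos hi]
    exact mul_ne_zero (h.pot_den i hi) (hfac i hi).1
  · intro i hi
    rw [hpot i hi, husum, hdsum]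
    have h₁ := h.potential i hi
    have h₂ := exp_le_factor (y := fun c => relWt k x i (M 7 c)) hr hd lam.cast_nonneg hη
      (fun c _ => relWt_nonneg k x i _) (fun c hcr => relWt_le hx hη₀ hi (hc c hcr))
    refine le_trans (le_of_eq ?_) (mul_le_mul h₁ h₂ (Real.exp_pos _).le (by positivity))
    rw [← Real.exp_add]
    congr 1
    ring
  · rw [Finset.sum_congr rfl fun i hi => hpot i (Finset.mem_range.1 hi)]
    exact hgood.trans h.pot_sum
  · intro i
    rw [e₅]
    split_ifs with hi
    · exact hsize _ _ (h.size_pot_num i) ((h.size_factor hL i d).1.trans (hΔ i hi d hd).1)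
    · have := h.size_pot_num i
      rw [hcard, Nat.add_mul]; omega
  · intro i
    rw [e₆]
    split_ifs with hi
    · exact hsize _ _ (h.size_pot_den i) ((h.size_factor hL i d).2.trans (hΔ i hi d hd).2)
    · have := h.size_pot_den i
      rw [hcard, Nat.add_mul]; omega

/-- Treating one tuple of edges preserves the invariant; afterwards the tuple is not a block all of
whose edges are unused. -/
theorem Invariant.exec_blockCmd {k r : ℕ} {lam : ℚ≥0} {adj : Expr} {η : ℝ} {x : List ℕ} {B Δ : ℕ}
    {M : Mem} (h : Invariant k r lam adj η x B Δ M) (hL : numEdges x ≤ inputSize x)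
    (hr : r = 2 ∨ r = 3) (hη₀ : 0 ≤ η) (hη : (lam : ℝ) * η ≤ 3 / 4) (hx : LightWord k η x)
    (hΔ : ∀ i < k, ∀ d < r, (factor k r lam i d).num.len * (inputSize x + B + 1 + 1) ≤ Δ ∧
      (factor k r lam i d).den.len * (inputSize x + B + 1 + 1) ≤ Δ)
    (hadj : ReadsInput adj)
    (hblock : ∀ b, (∀ c < r, b c < numEdges x) → IsBlock adj x b → Set.InjOn b (Finset.range r))
    (hc : ∀ c < r, M 7 c < numEdges x) :
    Invariant k r lam adj η x B Δ ((blockCmd k r lam adj).exec M) ∧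
      (blockCmd k r lam adj).exec M 7 = M 7 ∧
      (∀ j, M 2 j ≠ 0 → (blockCmd k r lam adj).exec M 2 j ≠ 0) ∧
      ¬ (IsBlock adj x (M 7) ∧ ∀ c < r, (blockCmd k r lam adj).exec M 2 (M 7 c) = 0) := by
  rw [blockCmd, Cmd.exec]
  have hcond : (Expr.mul adj (unusedExpr r)).val M ≠ 0 ↔
      IsBlock adj x (M 7) ∧ ∀ c < r, M 2 (M 7 c) = 0 := by
    rw [Expr.val, mul_ne_zero_iff, hadj.val_eq h.input, unusedExpr_val]
  by_cases hcd : (Expr.mul adj (unusedExpr r)).val M ≠ 0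
  swap
  · rw [if_neg hcd]
    exact ⟨h, rfl, fun _ h => h, fun h' => hcd (hcond.2 h')⟩
  rw [if_pos hcd]
  obtain ⟨hb, hun⟩ := hcond.1 hcd
  have hrel : ∀ i < k, ∀ c < r, (relWeight k i c).den.val M ≠ 0 ∧
      (relWeight k i c).val M = relWt k x i (M 7 c) := fun i hi c hcr =>
    relWeight_spec h.input (h.total_den i hi) (h.total i hi)
      (hx.den_ne_zero _ (hc c hcr) i hi) (wt_eq_zero (hc c hcr))
  have hfac : ∀ i < k, ∀ d < r, (factor k r lam i d).den.val M ≠ 0 ∧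
      (factor k r lam i d).val M = 1 + (lam : ℝ) *
        (relWt k x i (M 7 d) - (∑ c ∈ Finset.range r, relWt k x i (M 7 c)) / r) :=
    fun i hi d hd => factor_spec (y := fun c => relWt k x i (M 7 c)) hd (hrel i hi)
      ((Real.exp_pos _).le.trans (exp_le_factor (y := fun c => relWt k x i (M 7 c)) hr hd
        lam.cast_nonneg hη (fun c _ => relWt_nonneg k x i _)
        (fun c hcr => relWt_le hx hη₀ hi (hc c hcr))))
  have hgood : ∀ d < r, (goodChoice k r lam d).val M ≠ 0 ↔
      ∑ i ∈ Finset.range k, (M 5 i : ℝ) / (M 6 i : ℝ) * (1 + (lam : ℝ) *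
        (relWt k x i (M 7 d) - (∑ c ∈ Finset.range r, relWt k x i (M 7 c)) / r))
      ≤ ∑ i ∈ Finset.range k, (M 5 i : ℝ) / (M 6 i : ℝ) := by
    intro d hd
    obtain ⟨h₁, h₁'⟩ := FracExpr.sum_spec (M := M) (n := k) (f := pot) h.pot_den
    obtain ⟨h₂, h₂'⟩ := FracExpr.sum_spec (M := M) (n := k)
      (f := fun i => .mul (pot i) (factor k r lam i d))
      fun i hi => FracExpr.den_mul (h.pot_den i hi) (hfac i hi d hd).1
    rw [goodChoice, FracExpr.le_val h₂ h₁, h₁', h₂']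
    refine iff_of_eq (congrArg₂ _ (Finset.sum_congr rfl fun i hi => ?_) rfl)
    rw [FracExpr.val_mul, (hfac i (Finset.mem_range.1 hi) d hd).2]
    rfl
  obtain ⟨d₀, hd₀, hle⟩ := exists_choice (k := k) (r := r) (by omega)
    (fun i => (M 5 i : ℝ) / (M 6 i : ℝ)) lam (fun i c => relWt k x i (M 7 c))
  obtain ⟨d, hd, hg, he⟩ := exec_chooseCmd r ⟨d₀, hd₀, (hgood d₀ hd₀).2 hle⟩
  rw [he]
  have e₂ : ∀ j, (dropCmd k r lam d).exec M 2 j = if ∃ c < r, M 7 c = j then 1 else M 2 j :=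
    fun j => by rw [exec_dropCmd]; simp
  refine ⟨h.drop hL hr hη₀ hη hx hΔ hc hb (hblock _ hc hb) hun hd ((hgood d hd).1 hg)
    (fun i hi => hfac i hi d hd), ?_, ?_, ?_⟩
  · funext j
    rw [exec_dropCmd]; simp
  · intro j hj
    rw [e₂]
    split_ifs
    exacts [one_ne_zero, hj]
  · rintro ⟨-, h'⟩
    have := h' d hd
    rw [e₂, if_pos ⟨d, hd, rfl⟩] at this
    exact one_ne_zero this

/-! ### The loop that computes the total weights -/

/-- The invariant of the first loop: the first `j` edges have been read. The sharper bound
`size_den'` is what the induction for `size_num` needs,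
as the new numerator involves the denominator. -/
structure TallyInvariant (k : ℕ) (x : List ℕ) (j : ℕ) (M : Mem) : Prop where
  input : M 0 = fun i => x.getD i 0
  counter : M 7 0 ≤ numEdges x
  counter_zero : ∀ c, 1 ≤ c → M 7 c = 0
  other : ∀ a i, 8 ≤ a → M a i = 0
  flag : ∀ i, M 1 i = if i < j then 1 else 0
  mark : ∀ i, M 2 i = 0
  size_num : ∀ i, (M 3 i).size ≤ (j + 1) * (inputSize x + 1)
  size_den : ∀ i, (M 4 i).size ≤ (j + 1) * (inputSize x + 1)
  size_den' : ∀ i, (M 4 i).size ≤ 1 + j * inputSize x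
  total_den : ∀ i < k, M 4 i ≠ 0
  total : ∀ i < k, (M 3 i : ℝ) / (M 4 i : ℝ) = ∑ j' ∈ Finset.range j, wt k x i j'
  pot_num : ∀ i, M 5 i = if i < k then 1 else 0
  pot_den : ∀ i, M 6 i = if i < k then 1 else 0

theorem TallyInvariant.write_counter {k : ℕ} {x : List ℕ} {j : ℕ} {M : Mem}
    (h : TallyInvariant k x j M) (v : ℕ) (hv : v ≤ numEdges x) :
    TallyInvariant k x j (M.write 7 0 v) := by
  have e : ∀ a, a ≠ 7 → M.write 7 0 v a = M a := fun a ha => by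
    funext i; simp [Mem.write_apply, ha]
  constructor
  · rw [e 0 (by simp)]; exact h.input
  · simpa [Mem.write_apply] using hv
  · intro c hc
    rw [Mem.write_apply, if_neg (by omega)]
    exact h.counter_zero c hc
  · intro a i ha; rw [e a (by omega)]; exact h.other a i ha
  · rw [e 1 (by simp)]; exact h.flag
  · rw [e 2 (by simp)]; exact h.mark
  · rw [e 3 (by simp)]; exact h.size_num
  · rw [e 4 (by simp)]; exact h.size_den
  · rw [e 4 (by simp)]; exact h.size_den'
  · rw [e 4 (by simp)]; exact h.total_den
  · rw [e 3 (by simp), e 4 (by simp)]; exact h.total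
  · rw [e 5 (by simp)]; exact h.pot_num
  · rw [e 6 (by simp)]; exact h.pot_den

theorem TallyInvariant.bounded {k : ℕ} {x : List ℕ} {j : ℕ} {M : Mem}
    (h : TallyInvariant k x j M) (hL : numEdges x ≤ inputSize x) (hj : j ≤ inputSize x) :
    M.Bounded (inputSize x + (inputSize x + 1) * (inputSize x + 1) + 1) := by
  intro a i
  by_cases ha : 8 ≤ a
  · simp [h.other a i ha]
  have : (j + 1) * (inputSize x + 1) ≤ (inputSize x + 1) * (inputSize x + 1) :=
    Nat.mul_le_mul_right _ (by omega)
  have h0 : (M 0 i).size ≤ inputSize x := by rw [h.input]; exact size_le_inputSize x i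
  have h1 : (M 1 i).size ≤ 1 := size_le_one (by rw [h.flag]; split_ifs <;> simp)
  have h2 : (M 2 i).size ≤ 1 := size_le_one (by rw [h.mark]; simp)
  have h5 : (M 5 i).size ≤ 1 := size_le_one (by rw [h.pot_num]; split_ifs <;> simp)
  have h6 : (M 6 i).size ≤ 1 := size_le_one (by rw [h.pot_den]; split_ifs <;> simp)
  have h3 := h.size_num i
  have h4 := h.size_den i
  have h7 : (M 7 i).size ≤ inputSize x := by
    refine (size_le_self _).trans (le_trans ?_ hL)
    rcases Nat.eq_zero_or_pos i with rfl | hi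
    · exact h.counter
    · rw [h.counter_zero i hi]; exact Nat.zero_le _
  interval_cases a <;> omega

theorem TallyInvariant.step {k : ℕ} {η : ℝ} {x : List ℕ} {j : ℕ} {M : Mem}
    (h : TallyInvariant k x j M) (hx : LightWord k η x) (hj : j < numEdges x) (h₇ : M 7 0 = j) :
    TallyInvariant k x (j + 1) ((tallyCmd k).exec M) := by
  set M' := (tallyCmd k).exec M with hM'
  have ex : ∀ a i, M' a i = _ := exec_tallyCmd k h.input
  simp only [h₇] at ex
  have e : ∀ a, a ≠ 1 → a ≠ 3 → a ≠ 4 → M' a = M a := fun a h₁ h₃ h₄ => by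
    funext i; rw [ex]; simp [h₁, h₃, h₄]
  have e₀ := e 0 (by simp) (by simp) (by simp)
  have e₇ := e 7 (by simp) (by simp) (by simp)
  have e₃ : ∀ i, M' 3 i = if i < k then M 3 i * field k x j (3 + 2 * i)
      + field k x j (2 + 2 * i) * M 4 i else M 3 i := fun i => by rw [ex]; simp
  have e₄ : ∀ i, M' 4 i = if i < k then M 4 i * field k x j (3 + 2 * i) else M 4 i :=
    fun i => by rw [ex]; simp
  have hf : ∀ o, (field k x j o).size ≤ inputSize x := fun o => size_le_inputSize x _
  constructor
  · rw [e₀]; exact h.input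
  · rw [e₇]; exact h.counter
  · rw [e₇]; exact h.counter_zero
  · intro a i ha
    rw [e a (by omega) (by omega) (by omega)]
    exact h.other a i ha
  · intro i
    rw [ex, if_neg (by simp : ¬ ((1 : ℕ) = 3 ∧ i < k)), if_neg (by simp : ¬ ((1 : ℕ) = 4 ∧ i < k)),
      h.flag]
    simp only [true_and]
    split_ifs <;> omega
  · rw [e 2 (by simp) (by simp) (by simp)]; exact h.mark
  · intro i
    have h₁ := h.size_num i
    have h₂ := h.size_den' i
    rw [e₃]
    split_ifs
    · have h₃ := size_mul_le (M 3 i) (field k x j (3 + 2 * i))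
      have h₄ := size_mul_le (field k x j (2 + 2 * i)) (M 4 i)
      have h₅ := size_add_le (M 3 i * field k x j (3 + 2 * i)) (field k x j (2 + 2 * i) * M 4 i)
      have h₆ := hf (3 + 2 * i)
      have h₇ := hf (2 + 2 * i)
      have h₈ : (j + 1) * (inputSize x + 1) = j * inputSize x + j + inputSize x + 1 := by ring
      have h₉ : (j + 1 + 1) * (inputSize x + 1) =
          (j + 1) * (inputSize x + 1) + inputSize x + 1 := by ring
      have h₁₀ : max (M 3 i * field k x j (3 + 2 * i)).size (field k x j (2 + 2 * i) * M 4 i).size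
          ≤ (j + 1) * (inputSize x + 1) + inputSize x := max_le (by omega) (by omega)
      omega
    · rw [Nat.succ_mul]; omega
  · intro i
    have h₁ := h.size_den i
    rw [e₄, Nat.succ_mul (j + 1)]
    split_ifs
    · have h₃ := size_mul_le (M 4 i) (field k x j (3 + 2 * i))
      have h₆ := hf (3 + 2 * i)
      omega
    · omega
  · intro i
    have h₁ := h.size_den' i
    rw [e₄, Nat.succ_mul j]
    split_ifs
    · have h₃ := size_mul_le (M 4 i) (field k x j (3 + 2 * i))
      have h₆ := hf (3 + 2 * i)
      omega
    · omega
  · intro i hi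
    rw [e₄, if_pos hi]
    exact mul_ne_zero (h.total_den i hi) (hx.den_ne_zero j hj i hi)
  · intro i hi
    have h₄ : (M 4 i : ℝ) ≠ 0 := mod_cast h.total_den i hi
    have hd : (field k x j (3 + 2 * i) : ℝ) ≠ 0 := mod_cast hx.den_ne_zero j hj i hi
    rw [e₃, e₄, if_pos hi, if_pos hi, Finset.sum_range_succ, ← h.total i hi, wt]
    push_cast
    field_simp
  · rw [e 5 (by simp) (by simp) (by simp)]; exact h.pot_num
  · rw [e 6 (by simp) (by simp) (by simp)]; exact h.pot_den

theorem tallyInvariant_init (k : ℕ) (x : List ℕ) :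
    TallyInvariant k x 0 ((initCmd k).exec (initMem x)) := by
  set M' := (initCmd k).exec (initMem x) with hM'
  have ex : ∀ a i, M' a i = _ := exec_initCmd k (initMem x)
  simp only [initMem] at ex
  have e₄ : ∀ i, M' 4 i = if i < k then 1 else 0 := fun i => by rw [ex]; simp
  have e₃ : ∀ i, M' 3 i = 0 := fun i => by rw [ex]; simp
  have hs : ∀ i, (M' 4 i).size ≤ 1 := fun i => by rw [e₄]; split_ifs <;> simp
  constructor
  · funext i; rw [ex]; simp
  · rw [ex]; simp
  · intro c hc; rw [ex]; simp
  · intro a i ha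
    rw [ex, if_neg (by omega), if_neg (by omega)]
  · intro i; rw [ex]; simp
  · intro i; rw [ex]; simp
  · intro i; rw [e₃]; simp
  · intro i; have := hs i; omega
  · intro i; have := hs i; omega
  · intro i hi; rw [e₄, if_pos hi]; exact one_ne_zero
  · intro i hi; rw [e₃]; simp
  · intro i; rw [ex]; simp
  · intro i; rw [ex]; simp

theorem TallyInvariant.invariant {k r : ℕ} {lam : ℚ≥0} {adj : Expr} {η : ℝ} {x : List ℕ} {Δ : ℕ}
    {M : Mem} (h : TallyInvariant k x (numEdges x) M) (hL : numEdges x ≤ inputSize x) :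
    Invariant k r lam adj η x ((inputSize x + 1) * (inputSize x + 1)) Δ M := by
  have hB : (numEdges x + 1) * (inputSize x + 1) ≤ (inputSize x + 1) * (inputSize x + 1) :=
    Nat.mul_le_mul_right _ (by omega)
  have hd : dropped x M = ∅ := by
    refine Finset.filter_eq_empty_iff.2 fun j hj => ?_
    rw [h.flag, if_pos (Finset.mem_range.1 hj)]; exact one_ne_zero
  have hu : used x M = ∅ := by
    refine Finset.filter_eq_empty_iff.2 fun j hj => ?_
    rw [h.mark]; simp
  constructor
  · exact h.input
  · intro c
    rcases Nat.eq_zero_or_pos c with rfl | hc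
    · exact h.counter
    · rw [h.counter_zero c hc]; exact Nat.zero_le _
  · exact h.other
  · intro j; rw [h.flag]; split_ifs <;> simp
  · intro j; rw [h.mark]; simp
  · exact fun i => (h.size_num i).trans hB
  · exact fun i => (h.size_den i).trans hB
  · exact h.total_den
  · exact h.total
  · intro j hj hj'
    rw [h.flag, if_pos hj] at hj'
    exact absurd hj' one_ne_zero
  · intro j hj hj'
    exact absurd (h.mark j) hj'
  · intro i hi
    rw [h.pot_den, if_pos hi]; exact one_ne_zero
  · intro i hi
    rw [hd, hu, h.pot_num, h.pot_den, if_pos hi]; simp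
  · refine (Finset.sum_le_card_nsmul _ _ 1 fun i _ => ?_).trans (by simp)
    rw [h.pot_num, h.pot_den]; split_ifs <;> simp
  · intro i; rw [h.pot_num]; split_ifs <;> simp
  · intro i; rw [h.pot_den]; split_ifs <;> simp

/-! ### Correctness and running time of the program -/

/-- If the potential is at most `k` in the end, then enough weight of every objective is kept. -/
theorem Invariant.keeps {k r : ℕ} (hk : 2 ≤ k) {lam : ℚ≥0} {adj : Expr} {ε : ℝ} {x : List ℕ}
    {B Δ : ℕ} {M : Mem} (hε : 0 < ε) (hr : 0 < r) (hl₁ : 3 / 2 * Real.log k ≤ lam * ε)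
    (hl₂ : lam * ε ≤ 2 * Real.log k)
    (h : Invariant k r lam adj (eta k ε) x B Δ M) (i : ℕ) (hi : i < k) :
    (1 - 1 / r - ε) * totalWt k x i ≤
      ∑ j ∈ (Finset.range (numEdges x)).filter (M 1 · ≠ 0), wt k x i j := by
  rcases (totalWt_nonneg k x i).eq_or_lt with h₀ | h₀
  · rw [← h₀, mul_zero]
    exact Finset.sum_nonneg fun j _ => wt_nonneg k x i j
  have hlog : 0 < Real.log k := Real.log_pos (by exact_mod_cast hk)
  have hlam : 0 < (lam : ℝ) := by
    by_contra hneg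
    have : (lam : ℝ) = 0 := le_antisymm (not_lt.1 hneg) lam.cast_nonneg
    rw [this] at hl₁
    linarith
  have hr' : (1 : ℝ) ≤ r := by exact_mod_cast hr
  set X := ∑ j ∈ dropped x M, relWt k x i j with hX
  set u := ∑ j ∈ used x M, relWt k x i j with hu
  have hsplit : ∑ j ∈ (Finset.range (numEdges x)).filter (M 1 · ≠ 0), wt k x i j
      = totalWt k x i * (1 - X) := by
    have h₁ := Finset.sum_filter_add_sum_filter_not (Finset.range (numEdges x)) (M 1 · = 0)
      (wt k x i)
    have h₂ : ∑ j ∈ dropped x M, wt k x i j = totalWt k x i * X := by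
      rw [hX, Finset.mul_sum]
      refine Finset.sum_congr rfl fun j _ => ?_
      rw [relWt, mul_div_cancel₀ _ h₀.ne']
    rw [dropped] at h₂
    rw [h₂] at h₁
    change _ = totalWt k x i at h₁
    linarith
  have hu₁ : u ≤ 1 := by
    have h₁ : u ≤ ∑ j ∈ Finset.range (numEdges x), relWt k x i j :=
      Finset.sum_le_sum_of_subset_of_nonneg (Finset.filter_subset _ _)
        fun j _ _ => relWt_nonneg k x i j
    refine h₁.trans (le_of_eq ?_)
    simp only [relWt]
    rw [← Finset.sum_div]
    exact div_self h₀.ne'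
  have hu₀ : 0 ≤ u := Finset.sum_nonneg fun j _ => relWt_nonneg k x i j
  have hpot : Real.exp ((lam : ℝ) * (X - u / r) - (lam : ℝ) ^ 2 * (4 / 9 * eta k ε * u)) ≤ k :=
    (h.potential i hi).trans ((Finset.single_le_sum (f := fun i => (M 5 i : ℝ) / (M 6 i : ℝ))
      (fun _ _ => by positivity) (Finset.mem_range.2 hi)).trans h.pot_sum)
  have hpot := (Real.le_log_iff_exp_le (by positivity)).2 hpot
  have hη : (lam : ℝ) ^ 2 * eta k ε * (2 * Real.log k) = ((lam : ℝ) * ε) ^ 2 := by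
    rw [eta]; field_simp
  have hη₀ : 0 ≤ (lam : ℝ) ^ 2 * eta k ε := by unfold eta; positivity
  -- The loss above average is at most `ε` since `(2 c - 3) (c - 3) ≤ 0` for `c = lam ε / ln k`.
  have hquad : Real.log k + 4 / 9 * ((lam : ℝ) ^ 2 * eta k ε) ≤ lam * ε := by
    refine le_of_mul_le_mul_right ?_ (by positivity : 0 < 2 * Real.log k)
    nlinarith [mul_nonneg (sub_nonneg.2 hl₁) (sub_nonneg.2 hl₂)]
  have hv : (lam : ℝ) ^ 2 * (4 / 9 * eta k ε * u) ≤ 4 / 9 * ((lam : ℝ) ^ 2 * eta k ε) := by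
    nlinarith [mul_le_mul_of_nonneg_left hu₁ hη₀]
  have hXε : X - u / r ≤ ε := by
    refine le_of_mul_le_mul_left ?_ hlam
    linarith
  have hur : u / r ≤ 1 / r := div_le_div_of_nonneg_right hu₁ (by linarith)
  rw [hsplit, mul_comm]
  exact mul_le_mul_of_nonneg_left (by linarith) h₀.le

/-- The specification of `decomposeCmd`: on light input it runs in polynomial time, it keeps enough
weight of every objective, and every block shares an edge with a block that has a dropped edge.
A tuple is padded with zeros, as the counters from `r` on stay zero. -/
theorem decomposeCmd_spec {k r : ℕ} (hk : 2 ≤ k) {ε : ℝ} (hε : 0 < ε) (hr : r = 2 ∨ r = 3)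
    (hε' : ε ≤ 2 / 3) {lam : ℚ≥0} (hl₁ : 3 / 2 * Real.log k ≤ lam * ε)
    (hl₂ : lam * ε ≤ 2 * Real.log k) {adj : Expr} (hadj : ReadsInput adj) :
    ∃ p : Polynomial ℕ, ∀ x : List ℕ, numEdges x ≤ x.length → LightWord k (eta k ε) x →
      (∀ b, (∀ c < r, b c < numEdges x) → IsBlock adj x b → Set.InjOn b (Finset.range r)) →
      ∃ M t, Run (decomposeCmd k r lam adj) (initMem x) M t ∧ t ≤ p.eval (inputSize x) ∧
        (∀ i < k, (1 - 1 / r - ε) * totalWt k x i ≤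
          ∑ j ∈ (Finset.range (numEdges x)).filter (M 1 · ≠ 0), wt k x i j) ∧
        ∀ b, (∀ c < r, b c < numEdges x) → (∀ c, r ≤ c → b c = 0) → IsBlock adj x b →
          ∃ b', (∀ c < r, b' c < numEdges x) ∧ IsBlock adj x b' ∧
            (∃ c < r, ∃ c' < r, b c = b' c') ∧ ∃ d < r, M 1 (b' d) = 0 := by
  obtain ⟨K₀, hK₀⟩ := (loopFree_initCmd k).exists_run
  obtain ⟨K₁, hK₁⟩ := (loopFree_tallyCmd k).exists_run
  obtain ⟨K₂, hK₂⟩ := (loopFree_blockCmd k r lam adj).exists_run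
  have hlog : 0 < Real.log k := Real.log_pos (by exact_mod_cast hk)
  have hη₀ : 0 ≤ eta k ε := by unfold eta; positivity
  have hη : (lam : ℝ) * eta k ε ≤ 3 / 4 := by
    rw [eta, mul_div_assoc', div_le_iff₀ (by positivity)]
    nlinarith [mul_le_mul_of_nonneg_right hl₂ hε.le]
  set K := ∑ i ∈ Finset.range k, ∑ d ∈ Finset.range r,
    ((factor k r lam i d).num.len + (factor k r lam i d).den.len) with hK
  have hK' : ∀ i < k, ∀ d < r,
      (factor k r lam i d).num.len ≤ K ∧ (factor k r lam i d).den.len ≤ K := by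
    intro i hi d hd
    have : (factor k r lam i d).num.len + (factor k r lam i d).den.len ≤ K :=
      (Finset.single_le_sum (f := fun d => (factor k r lam i d).num.len
        + (factor k r lam i d).den.len) (fun _ _ => Nat.zero_le _) (Finset.mem_range.2 hd)).trans
      (Finset.single_le_sum (f := fun i => ∑ d ∈ Finset.range r, ((factor k r lam i d).num.len
        + (factor k r lam i d).den.len)) (fun _ _ => Nat.zero_le _) (Finset.mem_range.2 hi))
    omega
  set B : ℕ → ℕ := fun L => (L + 1) * (L + 1) with hB
  set Δ : ℕ → ℕ := fun L => K * (L + B L + 1 + 1) with hΔ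
  set T₁ : ℕ → ℕ := fun L => K₁ * (L + B L + 1 + 1) with hT₁
  set T₂ : ℕ → ℕ := fun L => K₂ * (L + B L + 1 + L * Δ L + 1) with hT₂
  have pid := PolyBounded.id
  have p₁ := PolyBounded.const 1
  have pB : PolyBounded B := (pid.add p₁).mul (pid.add p₁)
  have pS := ((pid.add pB).add p₁)
  have pΔ : PolyBounded Δ := (PolyBounded.const K).mul (pS.add p₁)
  have pT₁ : PolyBounded T₁ := (PolyBounded.const K₁).mul (pS.add p₁)
  have pT₂ : PolyBounded T₂ := (PolyBounded.const K₂).mul ((pS.add (pid.mul pΔ)).add p₁)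
  obtain ⟨p, hp⟩ := ((PolyBounded.const K₀).mul (pid.add p₁)).add
    (((pid.add p₁).mul (pT₁.add ((PolyBounded.const 20).mul ((pid.add (.const 0)).add p₁)))).add
      (pT₂.nestTime r))
  refine ⟨p, fun x hlen hx hinj => ?_⟩
  set L := inputSize x with hLdef
  have hL : numEdges x ≤ L := hlen.trans (length_le_inputSize x)
  have hb₀ : Mem.Bounded L (initMem x) := by
    intro a i
    unfold initMem
    split_ifs
    · exact size_le_inputSize x i
    · simp
  obtain ⟨-, t₀, ht₀, hr₀⟩ := hK₀ _ _ hb₀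
  obtain ⟨M₁, t₁, hr₁, ht₁, hI₁⟩ := run_forLoop (c := 0) (T := T₁ L) hL (p := tallyCmd k)
    (I := TallyInvariant k x) (fun j M h => by rw [h.input]; rfl)
    (fun j M v hv h => h.write_counter v hv)
    (fun j hj M h h₇ => by
      obtain ⟨-, t, ht, hrun⟩ := hK₁ _ _ (h.bounded hL (by omega))
      exact ⟨_, t, hrun, ht, h.step hx hj h₇, by rw [exec_tallyCmd k h.input]; simp [h₇]⟩)
    (tallyInvariant_init k x)
  have hI₂ : Invariant k r lam adj (eta k ε) x (B L) (Δ L) M₁ := hI₁.invariant hL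
  obtain ⟨M₂, t₂, hr₂, ht₂, hI₃, -, -, hG⟩ := run_nest (r := r) (T := T₂ L) hL
    (Inv := Invariant k r lam adj (eta k ε) x (B L) (Δ L))
    (G := fun b M => ¬ (IsBlock adj x b ∧ ∀ c < r, M 2 (b c) = 0)) (p := blockCmd k r lam adj)
    (fun M h => by rw [h.input]; rfl) (fun M c v hv h => h.write_counter c v hv)
    (fun b M c v h => by simpa [Mem.write_apply] using h)
    (fun M h hc => by
      obtain ⟨-, t, ht, hrun⟩ := hK₂ _ _ (h.bounded hL)
      obtain ⟨h₁, h₂, h₃, h₄⟩ := h.exec_blockCmd hL hr hη₀ hη hx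
        (fun i hi d hd => ⟨Nat.mul_le_mul_right _ (hK' i hi d hd).1,
          Nat.mul_le_mul_right _ (hK' i hi d hd).2⟩) hadj hinj hc
      refine ⟨_, t, hrun, ht, h₁, h₂, fun b hb ⟨hb₁, hb₂⟩ => hb ⟨hb₁, fun c hc => ?_⟩, h₄⟩
      by_contra hne
      exact h₃ _ hne (hb₂ c hc))
    r le_rfl M₁ hI₂ (fun c h h' => by omega)
  refine ⟨M₂, _, .seq hr₀ (.seq hr₁ hr₂), le_trans ?_ (hp L),
    fun i hi => hI₃.keeps hk hε (by omega) hl₁ hl₂ i hi, fun b hb hb₀ hblk => ?_⟩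
  · exact Nat.add_le_add ht₀ (Nat.add_le_add ht₁ ht₂)
  · have h₁ := hG b hb fun c hc => by rw [hb₀ c hc, hI₁.counter_zero c (by omega)]
    have h₂ : ∃ c < r, M₂ 2 (b c) ≠ 0 := by
      by_contra hne
      push Not at hne
      exact h₁ ⟨hblk, hne⟩
    obtain ⟨c, hc, hne⟩ := h₂
    obtain ⟨b', h₃, h₄, ⟨c', hc', h₅⟩, h₆⟩ := hI₃.block _ (hb c hc) hne
    exact ⟨b', h₃, h₄, ⟨c, hc, c', hc', h₅.symm⟩, h₆⟩

/-! ### Reading the input word -/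

theorem getD_flatten {c : ℕ} {L : List (List ℕ)} (hL : ∀ a ∈ L, a.length = c) {j s : ℕ}
    {a : List ℕ} (hj : L[j]? = some a) (hs : s < c) :
    L.flatten.getD (c * j + s) 0 = a.getD s 0 := by
  induction L generalizing j with
  | nil => simp at hj
  | cons b L ih =>
    have hb := hL b (by simp)
    rw [List.flatten_cons]
    cases j with
    | zero =>
      obtain rfl : b = a := by simpa using hj
      rw [List.getD_append _ _ _ _ (by omega)]
      simp
    | succ j =>
      rw [List.getD_append_right _ _ _ _ (by rw [hb, Nat.mul_succ]; omega), hb,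
        ← ih (fun a ha => hL a (by simp [ha])) (by simpa using hj)]
      congr 1
      rw [Nat.mul_succ]; omega

section Encoding

variable {n k : ℕ}

theorem length_encodeEdge (w : Fin k → Fin n × Fin n → ℚ≥0) (e : Fin n × Fin n) :
    (encodeEdge w e).length = 2 * k + 2 := by
  simp [encodeEdge, List.length_flatten, Function.comp_def, mul_comm]

theorem numEdges_encode (l : List (Fin n × Fin n)) (w : Fin k → Fin n × Fin n → ℚ≥0) :
    numEdges (encode l w) = l.length := by
  simp [numEdges, encode]

theorem numEdges_encode_le (l : List (Fin n × Fin n)) (w : Fin k → Fin n × Fin n → ℚ≥0) :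
    numEdges (encode l w) ≤ (encode l w).length := by
  rw [numEdges_encode]
  simp only [encode, List.length_cons, List.length_flatten, List.map_map, Function.comp_def,
    length_encodeEdge, List.map_const', List.sum_replicate, smul_eq_mul]
  nlinarith [Nat.zero_le (l.length * k)]

theorem field_encode {l : List (Fin n × Fin n)} {w : Fin k → Fin n × Fin n → ℚ≥0} {j o : ℕ}
    {e : Fin n × Fin n} (hj : l[j]? = some e) (ho : o < 2 * k + 2) :
    field k (encode l w) j o = (encodeEdge w e).getD o 0 := by
  rw [field, encode, show (2 * k + 2) * j + (2 + o) = (2 * k + 2) * j + o + 1 + 1 by ring,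
    List.getD_cons_succ, List.getD_cons_succ]
  refine getD_flatten (fun a ha => ?_) (by simp [hj]) ho
  obtain ⟨e, -, rfl⟩ := List.mem_map.1 ha
  exact length_encodeEdge w e

theorem field_tail {l : List (Fin n × Fin n)} {w : Fin k → Fin n × Fin n → ℚ≥0} {j : ℕ}
    {e : Fin n × Fin n} (hj : l[j]? = some e) : field k (encode l w) j 0 = e.1 := by
  rw [field_encode hj (by omega)]; simp [encodeEdge]

theorem field_head {l : List (Fin n × Fin n)} {w : Fin k → Fin n × Fin n → ℚ≥0} {j : ℕ}
    {e : Fin n × Fin n} (hj : l[j]? = some e) : field k (encode l w) j 1 = e.2 := by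
  rw [field_encode hj (by omega)]; simp [encodeEdge]

theorem field_weight {l : List (Fin n × Fin n)} {w : Fin k → Fin n × Fin n → ℚ≥0} {j : ℕ}
    {e : Fin n × Fin n} (hj : l[j]? = some e) (i : Fin k) :
    field k (encode l w) j (2 + 2 * i) = (w i e).num ∧
      field k (encode l w) j (3 + 2 * i) = (w i e).den := by
  have hi := i.2
  have h₁ : ∀ a ∈ List.ofFn (fun i => [(w i e).num, (w i e).den]), a.length = 2 := by
    intro a ha
    obtain ⟨i, rfl⟩ := List.mem_ofFn.1 ha
    rfl
  have h₂ : (List.ofFn (fun i => [(w i e).num, (w i e).den]))[(i : ℕ)]?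
      = some [(w i e).num, (w i e).den] := by simp [hi]
  constructor
  · have h₃ := getD_flatten h₁ h₂ (s := 0) (by omega)
    rw [Nat.add_zero] at h₃
    rw [field_encode hj (by omega), encodeEdge, show 2 + 2 * (i : ℕ) = 2 * i + 1 + 1 by ring,
      List.getD_cons_succ, List.getD_cons_succ, h₃]
    simp
  · rw [field_encode hj (by omega), encodeEdge, show 3 + 2 * (i : ℕ) = 2 * i + 1 + 1 + 1 by ring,
      List.getD_cons_succ, List.getD_cons_succ, getD_flatten h₁ h₂ (by omega)]
    simp

theorem wt_encode {l : List (Fin n × Fin n)} {w : Fin k → Fin n × Fin n → ℚ≥0} {j : ℕ}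
    {e : Fin n × Fin n} (hj : l[j]? = some e) (i : Fin k) :
    wt k (encode l w) i j = (w i e : ℝ) := by
  rw [wt, (field_weight hj i).1, (field_weight hj i).2]
  conv_rhs => rw [← (w i e).num_div_den]
  push_cast
  rfl

section

variable {E : Type} [DecidableEq E] (f : Fin n × Fin n → E) (w : Fin k → E → ℚ≥0)
  {l : List (Fin n × Fin n)}

theorem mem_returnedEdges {L : List E} (hL : L.Nodup) {j : ℕ} {e : E} (hj : L[j]? = some e)
    (M : Mem) : e ∈ returnedEdges L M ↔ M 1 j ≠ 0 := by
  obtain ⟨hlt, rfl⟩ := List.getElem?_eq_some_iff.1 hj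
  simp only [returnedEdges, Finset.mem_image, Finset.mem_filter, Finset.mem_univ, true_and]
  constructor
  · rintro ⟨j', h, he⟩
    have : (j' : ℕ) = j := (hL.getElem_inj_iff).1 he
    rwa [← this]
  · exact fun h => ⟨⟨j, hlt⟩, h, rfl⟩

theorem exists_getElem?_of_mem_returnedEdges {L : List E} {e : E} {M : Mem}
    (h : e ∈ returnedEdges L M) : ∃ j < L.length, L[j]? = some e := by
  obtain ⟨j, -, rfl⟩ := Finset.mem_image.1 h
  exact ⟨j, j.2, by simp⟩

theorem returnedEdges_subset (L : List E) (M : Mem) : returnedEdges L M ⊆ L.toFinset := by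
  intro e he
  obtain ⟨j, -, rfl⟩ := Finset.mem_image.1 he
  simp

theorem weight_returnedEdges (hl : (l.map f).Nodup) (M : Mem) (i : Fin k) :
    (weight w i (returnedEdges (l.map f) M) : ℝ) =
      ∑ j ∈ (Finset.range l.length).filter (M 1 · ≠ 0),
        wt k (encode l (fun i e => w i (f e))) i j := by
  have hinj : Function.Injective (l.map f).get := List.nodup_iff_injective_get.1 hl
  rw [weight, returnedEdges, Finset.sum_image fun a _ b _ h => hinj h, Finset.sum_filter,
    Finset.sum_filter, ← List.length_map (as := l) f, Finset.sum_range]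
  push_cast
  refine Finset.sum_congr rfl fun j _ => ?_
  have hj : (j : ℕ) < l.length := by simpa using j.2
  rw [wt_encode (List.getElem?_eq_getElem hj) i]
  split_ifs <;> simp

theorem totalWt_encode (hl : (l.map f).Nodup) (i : Fin k) :
    totalWt k (encode l (fun i e => w i (f e))) i = (weight w i (l.map f).toFinset : ℝ) := by
  have h := weight_returnedEdges f w hl (fun _ _ => 1) i
  rw [totalWt, numEdges_encode]
  simp only [ne_eq, one_ne_zero, not_false_eq_true, Finset.filter_true] at h
  rw [← h]
  congr 2
  ext e
  simp only [returnedEdges, ne_eq, one_ne_zero, not_false_eq_true, Finset.filter_true,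
    Finset.mem_image, Finset.mem_univ, true_and, List.mem_toFinset]
  exact List.mem_iff_get.symm

theorem lightWord_encode {η : ℝ} (hl : (l.map f).Nodup)
    (h : IsLight (1 / η) (l.map f).toFinset w) :
    LightWord k η (encode l (fun i e => w i (f e))) := by
  constructor
  · intro j hj i hi
    rw [numEdges_encode] at hj
    rw [(field_weight (List.getElem?_eq_getElem hj) ⟨i, hi⟩).2]
    exact NNRat.den_ne_zero _
  · intro j hj i hi
    rw [numEdges_encode] at hj
    have h₁ := h (f l[j]) (by simp only [List.mem_toFinset]; exact List.mem_map_of_mem (by simp))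
      ⟨i, hi⟩
    have h₂ := totalWt_encode f w hl ⟨i, hi⟩
    have h₃ := wt_encode (w := fun i e => w i (f e)) (List.getElem?_eq_getElem hj) ⟨i, hi⟩
    simp only at h₂ h₃
    rw [h₂, h₃]
    rw [div_div_eq_mul_div, div_one, mul_comm] at h₁
    exact h₁

theorem keepsFraction_encode {α : ℝ} (hl : (l.map f).Nodup) (M : Mem)
    (h : ∀ i < k, α * totalWt k (encode l (fun i e => w i (f e))) i ≤
      ∑ j ∈ (Finset.range (numEdges (encode l (fun i e => w i (f e))))).filter (M 1 · ≠ 0),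
        wt k (encode l (fun i e => w i (f e))) i j) :
    KeepsFraction α (l.map f).toFinset w (returnedEdges (l.map f) M) := by
  intro i
  have := h i i.2
  rwa [totalWt_encode f w hl, numEdges_encode, ← weight_returnedEdges f w hl] at this

theorem returnedEdges_initMem (L : List E) (x : List ℕ) : returnedEdges L (initMem x) = ∅ := by
  simp [returnedEdges, initMem]

end

/-- If nothing has to be kept, then the empty set of edges is returned at once. -/
theorem keepsFraction_empty {E : Type} {α : ℝ} (hα : α ≤ 0) (w : Fin k → E → ℚ≥0) (C : Finset E) :
    KeepsFraction α C w ∅ := by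
  intro i
  simp only [weight, Finset.sum_empty, NNRat.cast_zero]
  exact mul_nonpos_of_nonpos_of_nonneg hα (NNRat.cast_nonneg _)

/-! ### Blocks of adjacent edges -/

/-- The condition `x = y`. -/
def eqExpr (x y : Expr) : Expr := .sub (.const 1) (.add (.sub x y) (.sub y x))

/-- The condition that counters `c` and `c'` differ. -/
def neExpr (c c' : ℕ) : Expr :=
  .add (.sub (.read 7 (.const c)) (.read 7 (.const c')))
    (.sub (.read 7 (.const c')) (.read 7 (.const c)))

/-- The condition that two edges are consecutive: the first ends where the second starts. -/
def directedAdj (k : ℕ) : Expr := eqExpr (entry k 0 1) (entry k 1 0)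

/-- The condition that the edges with indices `c` and `c'` have an endpoint in common. -/
def shareExpr (k c c' : ℕ) : Expr :=
  .add (.add (eqExpr (entry k c 0) (entry k c' 0)) (eqExpr (entry k c 0) (entry k c' 1)))
    (.add (eqExpr (entry k c 1) (entry k c' 0)) (eqExpr (entry k c 1) (entry k c' 1)))

/-- The condition that three distinct edges form a path or a triangle, the second being adjacent to
the other two. (In a graph of maximum degree two they cannot form a star.) -/
def undirectedAdj (k : ℕ) : Expr :=
  .mul (.mul (shareExpr k 0 1) (shareExpr k 1 2))
    (.mul (.mul (neExpr 0 1) (neExpr 1 2)) (neExpr 0 2))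

theorem eqExpr_val (M : Mem) (x y : Expr) : (eqExpr x y).val M ≠ 0 ↔ x.val M = y.val M := by
  simp only [eqExpr, Expr.val]; omega

theorem neExpr_val (M : Mem) (c c' : ℕ) : (neExpr c c').val M ≠ 0 ↔ M 7 c ≠ M 7 c' := by
  simp only [neExpr, Expr.val]; omega

theorem readsInput_directedAdj (k : ℕ) : ReadsInput (directedAdj k) := by
  intro M M' h₀ h₇
  simp [directedAdj, eqExpr, entry, Expr.val, h₀, h₇]

theorem readsInput_undirectedAdj (k : ℕ) : ReadsInput (undirectedAdj k) := by
  intro M M' h₀ h₇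
  simp [undirectedAdj, shareExpr, neExpr, eqExpr, entry, Expr.val, h₀, h₇]

theorem entry_blockMem (k c o : ℕ) (x : List ℕ) (b : ℕ → ℕ) :
    (entry k c o).val (blockMem x b) = field k x (b c) o := by
  rw [entry_val (x := x) (by rfl)]; rfl

theorem isBlock_directedAdj {l : List (Fin n × Fin n)} {w : Fin k → Fin n × Fin n → ℚ≥0}
    {b : ℕ → ℕ} {e e' : Fin n × Fin n} (h₀ : l[b 0]? = some e) (h₁ : l[b 1]? = some e') :
    IsBlock (directedAdj k) (encode l w) b ↔ e.2 = e'.1 := by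
  rw [IsBlock, directedAdj, eqExpr_val, entry_blockMem, entry_blockMem, field_head h₀,
    field_tail h₁, Fin.ext_iff]

theorem shareExpr_val {l : List (Fin n × Fin n)} {w : Fin k → Fin n × Fin n → ℚ≥0}
    {b : ℕ → ℕ} {c c' : ℕ} {e e' : Fin n × Fin n} (h : l[b c]? = some e) (h' : l[b c']? = some e') :
    (shareExpr k c c').val (blockMem (encode l w) b) ≠ 0 ↔
      ∃ v, v ∈ toUndirected e ∧ v ∈ toUndirected e' := by
  have key : ∀ a b c d : ℕ, a + b + (c + d) ≠ 0 ↔ (a ≠ 0 ∨ b ≠ 0) ∨ (c ≠ 0 ∨ d ≠ 0) := by omega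
  rw [shareExpr, Expr.val, Expr.val, Expr.val, key]
  simp only [eqExpr_val, entry_blockMem, field_tail h, field_tail h', field_head h, field_head h',
    ← Fin.ext_iff, toUndirected, Sym2.mem_iff]
  constructor
  · rintro ((h | h) | (h | h))
    exacts [⟨e.1, by simp [h]⟩, ⟨e.1, by simp [h]⟩, ⟨e.2, by simp [h]⟩, ⟨e.2, by simp [h]⟩]
  · rintro ⟨v, rfl | rfl, h | h⟩ <;> simp [h]

theorem isBlock_undirectedAdj {l : List (Fin n × Fin n)} {w : Fin k → Fin n × Fin n → ℚ≥0}
    {b : ℕ → ℕ} {e₀ e₁ e₂ : Fin n × Fin n} (h₀ : l[b 0]? = some e₀) (h₁ : l[b 1]? = some e₁)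
    (h₂ : l[b 2]? = some e₂) :
    IsBlock (undirectedAdj k) (encode l w) b ↔
      ((∃ v, v ∈ toUndirected e₀ ∧ v ∈ toUndirected e₁) ∧
        ∃ v, v ∈ toUndirected e₁ ∧ v ∈ toUndirected e₂) ∧
      (b 0 ≠ b 1 ∧ b 1 ≠ b 2) ∧ b 0 ≠ b 2 := by
  have h₇ : ∀ c, blockMem (encode l w) b 7 c = b c := fun c => rfl
  rw [IsBlock, undirectedAdj]
  simp only [Expr.val, mul_ne_zero_iff, neExpr_val, shareExpr_val h₀ h₁, shareExpr_val h₁ h₂, h₇]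

/-! ### Every cycle is broken -/

/-- The kept edges of a directed cycle cover contain no cycle if each pair of consecutive edges
meets a pair of consecutive edges one of which is dropped. -/
theorem not_transGen_returnedEdges {l : List (Fin n × Fin n)} (hl : l.Nodup)
    (hC : IsDirectedCycleCover l.toFinset) {M : Mem}
    (hM : ∀ (i j : ℕ) e e', l[i]? = some e → l[j]? = some e' → e.2 = e'.1 →
      ∃ (i' j' : ℕ) (f f' : _), l[i']? = some f ∧ l[j']? = some f' ∧ f.2 = f'.1 ∧
        (f = e ∨ f = e' ∨ f' = e ∨ f' = e') ∧ (M 1 i' = 0 ∨ M 1 j' = 0)) (v : Fin n) :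
    ¬ Relation.TransGen (fun a b => (a, b) ∈ returnedEdges l M) v v := by
  intro hv
  obtain ⟨-, hout, hin⟩ := hC
  set R : Fin n → Fin n → Prop := fun a b => (a, b) ∈ returnedEdges l M with hR
  have hPC : ∀ {a b}, R a b → (a, b) ∈ l.toFinset := fun h => returnedEdges_subset l M h
  -- `Z` consists of the kept edges on the cycle through `v`.
  set Z : Fin n × Fin n → Prop :=
    fun e => R e.1 e.2 ∧ Relation.TransGen R v e.1 ∧ Relation.TransGen R e.1 v with hZ
  have hnext : ∀ e e', e' ∈ l → e.2 = e'.1 → Z e → Z e' := by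
    rintro ⟨a, b⟩ ⟨b', c⟩ he' rfl ⟨h₁, h₂, h₃⟩
    simp only at h₁ h₂ h₃
    have h₄ : Relation.TransGen R v b := h₂.tail h₁
    have h₅ : Relation.TransGen R b v := by
      obtain ⟨b', hb', hb''⟩ := Relation.TransGen.head'_iff.1 h₃
      obtain rfl := (hout a).unique (hPC hb') (hPC h₁)
      rcases Relation.reflTransGen_iff_eq_or_transGen.1 hb'' with rfl | h
      exacts [hv, h]
    obtain ⟨c', hc', -⟩ := Relation.TransGen.head'_iff.1 h₅
    obtain rfl := (hout b).unique (hPC hc') (List.mem_toFinset.2 he')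
    exact ⟨hc', h₄, h₅⟩
  have hprev : ∀ e e', e ∈ l → e.2 = e'.1 → Z e' → Z e := by
    rintro ⟨a, b⟩ ⟨b', c⟩ he rfl ⟨h₁, h₂, h₃⟩
    simp only at h₁ h₂ h₃
    obtain ⟨a', ha', hab⟩ := Relation.TransGen.tail'_iff.1 h₂
    obtain rfl := (hin b).unique (hPC hab) (List.mem_toFinset.2 he)
    refine ⟨hab, ?_, Relation.TransGen.head hab h₃⟩
    rcases Relation.reflTransGen_iff_eq_or_transGen.1 ha' with rfl | h
    exacts [hv, h]
  obtain ⟨u, hu, -⟩ := Relation.TransGen.head'_iff.1 hv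
  obtain ⟨t, -, ht⟩ := Relation.TransGen.tail'_iff.1 hv
  obtain ⟨i, -, hi⟩ := exists_getElem?_of_mem_returnedEdges ht
  obtain ⟨j, -, hj⟩ := exists_getElem?_of_mem_returnedEdges hu
  have hZj : Z (v, u) := ⟨hu, hv, hv⟩
  have hZi : Z (t, v) := hprev _ (v, u) (List.mem_of_getElem? hi) rfl hZj
  obtain ⟨i', j', f, f', hi', hj', hff, hmeet, hdrop⟩ := hM i j _ _ hi hj rfl
  have hfl := List.mem_of_getElem? hi'
  have hfl' := List.mem_of_getElem? hj'
  have hZf : Z f ∧ Z f' := by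
    rcases hmeet with rfl | rfl | rfl | rfl
    · exact ⟨hZi, hnext _ _ hfl' hff hZi⟩
    · exact ⟨hZj, hnext _ _ hfl' hff hZj⟩
    · exact ⟨hprev _ _ hfl hff hZi, hZi⟩
    · exact ⟨hprev _ _ hfl hff hZj, hZj⟩
  rcases hdrop with h | h
  · exact (mem_returnedEdges hl hi' M).1 hZf.1.1 h
  · exact (mem_returnedEdges hl hj' M).1 hZf.2.1 h

end Encoding

theorem exists_three_edges {V : Type} {G : SimpleGraph V} {u v : V} (p : G.Walk u v)
    (hp : 3 ≤ p.length) :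
    ∃ a b c es, p.edges = s(u, a) :: s(a, b) :: s(b, c) :: es := by
  cases p with
  | nil => simp at hp
  | cons h p =>
    cases p with
    | nil => simp at hp
    | cons h p =>
      cases p with
      | nil => simp at hp
      | cons h p => exact ⟨_, _, _, _, rfl⟩

/-- A cycle in a graph of maximum degree two contains every edge that it touches. -/
theorem mem_edges_of_isCycle {V : Type} [DecidableEq V] {C P : Finset (Sym2 V)} (hPC : P ⊆ C)
    (hC : ∀ v, degree C v = 2) {v : V} {c : (SimpleGraph.fromEdgeSet (P : Set (Sym2 V))).Walk v v}
    (hc : c.IsCycle) {e e' : Sym2 V} (he : e ∈ c.edges) (he' : e' ∈ C) {u : V} (hu : u ∈ e)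
    (hu' : u ∈ e') : e' ∈ c.edges := by
  have hsupp : u ∈ c.support := SimpleGraph.Walk.mem_support_of_mem_edges he hu
  obtain ⟨a, b, hab, hN⟩ := Set.ncard_eq_two.1 (hc.ncard_neighborSet_toSubgraph_eq_two hsupp)
  have hmem : ∀ x, x ∈ ({a, b} : Set V) → s(u, x) ∈ c.edges := fun x hx => by
    rw [← hN] at hx
    exact SimpleGraph.Walk.adj_toSubgraph_iff_mem_edges.1 hx
  have ha := hmem a (by simp)
  have hb := hmem b (by simp)
  have hsub : ∀ x ∈ c.edges, x ∈ C := fun x hx => by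
    have := c.edges_subset_edgeSet hx
    rw [SimpleGraph.edgeSet_fromEdgeSet] at this
    exact hPC this.1
  have hne : s(u, a) ≠ s(u, b) := fun h => hab (Sym2.congr_right.1 h)
  have heq : ({s(u, a), s(u, b)} : Finset (Sym2 V)) = C.filter (fun e => u ∈ e) := by
    refine Finset.eq_of_subset_of_card_le (fun x hx => ?_) ?_
    · simp only [Finset.mem_insert, Finset.mem_singleton] at hx
      rcases hx with rfl | rfl <;> simp [hsub _ ha, hsub _ hb]
    · rw [Finset.card_pair hne]
      exact (hC u).le
  have : e' ∈ ({s(u, a), s(u, b)} : Finset (Sym2 V)) := by rw [heq]; simp [he', hu']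
  simp only [Finset.mem_insert, Finset.mem_singleton] at this
  rcases this with rfl | rfl
  exacts [ha, hb]

/-- The kept edges of an undirected cycle cover contain no cycle if each triple of adjacent edges
meets such a triple that has a dropped edge. -/
theorem isAcyclic_returnedEdges {V : Type} [DecidableEq V] {L : List (Sym2 V)} (hL : L.Nodup)
    (hC : IsUndirectedCycleCover L.toFinset) {M : Mem}
    (hM : ∀ (b : Fin 3 → ℕ) (e : Fin 3 → Sym2 V), (∀ c, L[b c]? = some (e c)) →
      Function.Injective b → (∃ v, v ∈ e 0 ∧ v ∈ e 1) → (∃ v, v ∈ e 1 ∧ v ∈ e 2) →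
      ∃ (b' : Fin 3 → ℕ) (e' : Fin 3 → Sym2 V), (∀ c, L[b' c]? = some (e' c)) ∧
        (∃ v, v ∈ e' 0 ∧ v ∈ e' 1) ∧ (∃ v, v ∈ e' 1 ∧ v ∈ e' 2) ∧
        (∃ c c', e c = e' c') ∧ ∃ d, M 1 (b' d) = 0) :
    (SimpleGraph.fromEdgeSet (returnedEdges L M : Set (Sym2 V))).IsAcyclic := by
  intro v p hp
  have hPC := returnedEdges_subset L M
  have hmem : ∀ x ∈ p.edges, x ∈ returnedEdges L M := fun x hx => by
    have := p.edges_subset_edgeSet hx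
    rw [SimpleGraph.edgeSet_fromEdgeSet] at this
    exact this.1
  have hstep : ∀ {x y}, y ∈ L → (∃ u, u ∈ x ∧ u ∈ y) → x ∈ p.edges → y ∈ p.edges :=
    fun hy ⟨u, hu, hu'⟩ hx =>
      mem_edges_of_isCycle hPC hC.2 hp hx (List.mem_toFinset.2 hy) hu hu'
  have hstep' : ∀ {x y}, x ∈ L → (∃ u, u ∈ x ∧ u ∈ y) → y ∈ p.edges → x ∈ p.edges :=
    fun hx ⟨u, hu, hu'⟩ hy =>
      mem_edges_of_isCycle hPC hC.2 hp hy (List.mem_toFinset.2 hx) hu' hu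
  obtain ⟨a, b, c, es, hes⟩ := exists_three_edges p hp.three_le_length
  have hnd := hp.isCircuit.isTrail.edges_nodup
  have hall : ∀ i : Fin 3, (![s(v, a), s(a, b), s(b, c)] : Fin 3 → Sym2 V) i ∈ p.edges := by
    intro i
    rw [hes]
    fin_cases i <;> simp
  have hidx : ∀ i : Fin 3, ∃ j, L[j]? = some ((![s(v, a), s(a, b), s(b, c)] : Fin 3 → Sym2 V) i) :=
    fun i => by
      obtain ⟨j, -, hj⟩ := exists_getElem?_of_mem_returnedEdges (hmem _ (hall i))
      exact ⟨j, hj⟩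
  choose j hj using hidx
  have hinj : Function.Injective j := by
    have hinj' : Function.Injective (![s(v, a), s(a, b), s(b, c)] : Fin 3 → Sym2 V) := by
      rw [hes] at hnd
      exact List.nodup_ofFn.1 (List.Nodup.of_append_left (l₂ := es) hnd)
    intro x y hxy
    refine hinj' (Option.some_injective _ ?_)
    rw [← hj x, ← hj y, hxy]
  obtain ⟨b', e', hb', h₀₁, h₁₂, ⟨i, i', hii⟩, d, hd⟩ := hM j _ hj hinj
    ⟨a, by simp⟩ ⟨b, by simp⟩
  have hL' : ∀ i, e' i ∈ L := fun i => List.mem_of_getElem? (hb' i)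
  have h₁ : e' 1 ∈ p.edges := by
    have := hall i
    rw [hii] at this
    fin_cases i'
    · exact hstep (hL' 1) h₀₁ this
    · exact this
    · exact hstep' (hL' 1) h₁₂ this
  have hd' : e' d ∈ p.edges := by
    fin_cases d
    · exact hstep' (hL' 0) h₀₁ h₁
    · exact h₁
    · exact hstep (hL' 2) h₁₂ h₁
  exact (mem_returnedEdges hL (hb' d) M).1 (hmem _ hd') hd

/-! ### The two decomposition algorithms -/

/-- A rational learning rate: `lam * ε / ln k` lies between `3 / 2` and `2`. -/
theorem exists_rate {k : ℕ} (hk : 2 ≤ k) {ε : ℝ} (hε : 0 < ε) :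
    ∃ lam : ℚ≥0, 3 / 2 * Real.log k ≤ lam * ε ∧ lam * ε ≤ 2 * Real.log k := by
  have hlog : 0 < Real.log k := Real.log_pos (by exact_mod_cast hk)
  obtain ⟨q, hq₁, hq₂⟩ := exists_rat_btwn
    (show 3 / 2 * Real.log k / ε < 2 * Real.log k / ε from
      div_lt_div_of_pos_right (by linarith) hε)
  have hq : (0 : ℝ) ≤ q := le_trans (by positivity) hq₁.le
  refine ⟨⟨q, by exact_mod_cast hq⟩, ?_, ?_⟩
  · exact ((div_lt_iff₀ hε).1 hq₁).le
  · exact ((lt_div_iff₀ hε).1 hq₂).le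

theorem exists_directed_algorithm {k : ℕ} (hk : 2 ≤ k) {ε : ℝ} (hε : 0 < ε) (hε' : ε < 1 / 2) :
    ∃ (prog : Cmd) (p : Polynomial ℕ),
      ∀ (n : ℕ) (w : Fin k → Fin n × Fin n → ℚ≥0) (l : List (Fin n × Fin n)), l.Nodup →
        IsDirectedCycleCover l.toFinset → IsLight (1 / eta k ε) l.toFinset w →
          ∃ (M : Mem) (t : ℕ), Run prog (initMem (encode l w)) M t ∧
            t ≤ p.eval (inputSize (encode l w)) ∧
            IsDirectedDecomposition (1 / 2 - ε) l.toFinset w (returnedEdges l M) := by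
  obtain ⟨lam, hl₁, hl₂⟩ := exists_rate hk hε
  obtain ⟨p, hp⟩ := decomposeCmd_spec hk hε (Or.inl rfl) (by linarith) hl₁ hl₂
    (readsInput_directedAdj k)
  refine ⟨decomposeCmd k 2 lam (directedAdj k), p, fun n w l hl hC hlight => ?_⟩
  have hid : l.map id = l := List.map_id l
  have hget : ∀ j, j < l.length → ∃ e, l[j]? = some e :=
    fun j hj => ⟨_, List.getElem?_eq_getElem hj⟩
  obtain ⟨M, t, hrun, ht, hkeep, hblock⟩ := hp (encode l w) (numEdges_encode_le l w)
    (lightWord_encode id w (by rwa [hid]) (by rwa [hid])) (by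
      intro b hb hblk
      rw [numEdges_encode] at hb
      obtain ⟨e, he⟩ := hget _ (hb 0 (by norm_num))
      obtain ⟨e', he'⟩ := hget _ (hb 1 (by norm_num))
      have hadj := (isBlock_directedAdj he he').1 hblk
      have hne : b 0 ≠ b 1 := by
        intro h
        rw [h, he'] at he
        obtain rfl : e' = e := Option.some_injective _ he
        exact hC.1 _ (List.mem_toFinset.2 (List.mem_of_getElem? he')) hadj.symm
      intro c hc c' hc' h
      have hc := Finset.mem_range.1 hc
      have hc' := Finset.mem_range.1 hc'
      interval_cases c <;> interval_cases c' <;> first | rfl | exact absurd h hne |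
        exact absurd h.symm hne)
  refine ⟨M, t, hrun, ht, returnedEdges_subset l M, ⟨?_, ?_, ?_⟩, ?_⟩
  · intro u v v' h h'
    exact (hC.2.1 u).unique (returnedEdges_subset l M h) (returnedEdges_subset l M h')
  · intro u u' v h h'
    exact (hC.2.2 v).unique (returnedEdges_subset l M h) (returnedEdges_subset l M h')
  · refine not_transGen_returnedEdges hl hC fun i j e e' hi hj hee => ?_
    have hi' := (List.getElem?_eq_some_iff.1 hi).1
    have hj' := (List.getElem?_eq_some_iff.1 hj).1
    simp only [numEdges_encode] at hblock
    obtain ⟨b', hb', hblk, ⟨c, hc, c', hc', hcc⟩, d, hd, hM⟩ := hblock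
      (fun c => if c = 0 then i else if c = 1 then j else 0)
      (fun c hc => by interval_cases c <;> simpa)
      (fun c hc => by rw [if_neg (by omega), if_neg (by omega)])
      ((isBlock_directedAdj (by simpa using hi) (by simpa using hj)).2 hee)
    obtain ⟨f, hf⟩ := hget _ (hb' 0 (by norm_num))
    obtain ⟨f', hf'⟩ := hget _ (hb' 1 (by norm_num))
    have heq : ∀ {i j : ℕ} {e f : Fin n × Fin n}, l[i]? = some e → l[j]? = some f → i = j →
        f = e := by
      rintro i j e f h h' rfl
      exact Option.some_injective _ (h'.symm.trans h)
    refine ⟨b' 0, b' 1, f, f', hf, hf', (isBlock_directedAdj hf hf').1 hblk, ?_, ?_⟩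
    · interval_cases c <;> interval_cases c'
      · exact Or.inl (heq hi hf hcc)
      · exact Or.inr (Or.inr (Or.inl (heq hi hf' hcc)))
      · exact Or.inr (Or.inl (heq hj hf hcc))
      · exact Or.inr (Or.inr (Or.inr (heq hj hf' hcc)))
    · interval_cases d
      exacts [Or.inl hM, Or.inr hM]
  · have := keepsFraction_encode (α := 1 / 2 - ε) id w (l := l) (by rwa [hid]) M (by
      intro i hi
      have := hkeep i hi
      norm_num at this ⊢
      exact this)
    rwa [hid] at this

theorem exists_undirected_algorithm {k : ℕ} (hk : 2 ≤ k) {ε : ℝ} (hε : 0 < ε) (hε' : ε < 2 / 3) :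
    ∃ (prog : Cmd) (p : Polynomial ℕ),
      ∀ (n : ℕ) (w : Fin k → Sym2 (Fin n) → ℚ≥0) (l : List (Fin n × Fin n)),
        (l.map toUndirected).Nodup → IsUndirectedCycleCover (l.map toUndirected).toFinset →
        IsLight (1 / eta k ε) (l.map toUndirected).toFinset w →
          ∃ (M : Mem) (t : ℕ),
            Run prog (initMem (encode l (fun i e => w i (toUndirected e)))) M t ∧
            t ≤ p.eval (inputSize (encode l (fun i e => w i (toUndirected e)))) ∧
            IsUndirectedDecomposition (2 / 3 - ε) (l.map toUndirected).toFinset w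
              (returnedEdges (l.map toUndirected) M) := by
  obtain ⟨lam, hl₁, hl₂⟩ := exists_rate hk hε
  obtain ⟨p, hp⟩ := decomposeCmd_spec hk hε (Or.inr rfl) hε'.le hl₁ hl₂
    (readsInput_undirectedAdj k)
  refine ⟨decomposeCmd k 3 lam (undirectedAdj k), p, fun n w l hl hC hlight => ?_⟩
  have hget : ∀ j, j < l.length → ∃ e, l[j]? = some e :=
    fun j hj => ⟨_, List.getElem?_eq_getElem hj⟩
  obtain ⟨M, t, hrun, ht, hkeep, hblock⟩ := hp (encode l (fun i e => w i (toUndirected e)))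
    (numEdges_encode_le l _) (lightWord_encode toUndirected w hl hlight) (by
      intro b hb hblk
      rw [numEdges_encode] at hb
      obtain ⟨e₀, h₀⟩ := hget _ (hb 0 (by norm_num))
      obtain ⟨e₁, h₁⟩ := hget _ (hb 1 (by norm_num))
      obtain ⟨e₂, h₂⟩ := hget _ (hb 2 (by norm_num))
      obtain ⟨-, ⟨h₀₁, h₁₂⟩, h₀₂⟩ := (isBlock_undirectedAdj h₀ h₁ h₂).1 hblk
      intro c hc c' hc' h
      have hc := Finset.mem_range.1 hc
      have hc' := Finset.mem_range.1 hc'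
      interval_cases c <;> interval_cases c' <;> omega)
  refine ⟨M, t, hrun, ht, returnedEdges_subset _ M, ⟨?_, ?_, ?_⟩, ?_⟩
  · exact fun e he => hC.1 e (returnedEdges_subset _ M he)
  · intro v
    rw [← hC.2 v]
    exact Finset.card_le_card (Finset.filter_subset_filter _ (returnedEdges_subset _ M))
  · refine isAcyclic_returnedEdges hl hC fun b e hb hinj h₀₁ h₁₂ => ?_
    simp only [List.getElem?_map, Option.map_eq_some_iff] at hb
    choose a ha hae using hb
    simp only [numEdges_encode] at hblock
    obtain ⟨b', hb', hblk, ⟨c, hc, c', hc', hcc⟩, d, hd, hM⟩ := hblock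
      (fun c => if h : c < 3 then b ⟨c, h⟩ else 0)
      (fun c hc => by
        rw [dif_pos hc]
        exact (List.getElem?_eq_some_iff.1 (ha _)).1)
      (fun c hc => by rw [dif_neg (by omega)])
      ((isBlock_undirectedAdj (ha 0) (ha 1) (ha 2)).2 ⟨⟨by rwa [hae, hae], by rwa [hae, hae]⟩,
        ⟨hinj.ne (by simp), hinj.ne (by simp)⟩, hinj.ne (by simp)⟩)
    have hget' : ∀ c : Fin 3, ∃ e, l[b' c]? = some e := fun c => hget _ (hb' c c.2)
    choose a' ha' using hget'
    obtain ⟨⟨h₀₁', h₁₂'⟩, -⟩ := (isBlock_undirectedAdj (ha' 0) (ha' 1) (ha' 2)).1 hblk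
    refine ⟨fun c => b' c, fun c => toUndirected (a' c), fun c => by simp [ha'], h₀₁', h₁₂',
      ⟨⟨c, hc⟩, ⟨c', hc'⟩, ?_⟩, ⟨d, hd⟩, hM⟩
    rw [← hae]
    rw [dif_pos hc] at hcc
    have h₁ := ha ⟨c, hc⟩
    rw [hcc, ha' ⟨c', hc'⟩] at h₁
    exact congrArg toUndirected (Option.some_injective _ h₁).symm
  · refine keepsFraction_encode (α := 2 / 3 - ε) toUndirected w hl M fun i hi => ?_
    have := hkeep i hi
    norm_num at this ⊢
    exact this

end CycleDecomp

theorem mainTheorem9 (k : ℕ) (hk : 2 ≤ k) (ε : ℝ) (hε : 0 < ε) :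
    (∃ (prog : CycleDecomp.Cmd) (p : Polynomial ℕ),
      ∀ (n : ℕ) (C : Finset (Fin n × Fin n)) (w : Fin k → Fin n × Fin n → ℚ≥0),
        CycleDecomp.IsDirectedCycleCover C →
        CycleDecomp.IsLight (1 / CycleDecomp.eta k ε) C w →
        ∀ l : List (Fin n × Fin n), l.Nodup → l.toFinset = C →
          ∃ (M : CycleDecomp.Mem) (t : ℕ),
            CycleDecomp.Run prog (CycleDecomp.initMem (CycleDecomp.encode l w)) M t ∧
            t ≤ p.eval (CycleDecomp.inputSize (CycleDecomp.encode l w)) ∧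
            CycleDecomp.IsDirectedDecomposition (1 / 2 - ε) C w
              (CycleDecomp.returnedEdges l M)) ∧
    (∃ (prog : CycleDecomp.Cmd) (p : Polynomial ℕ),
      ∀ (n : ℕ) (C : Finset (Sym2 (Fin n))) (w : Fin k → Sym2 (Fin n) → ℚ≥0),
        CycleDecomp.IsUndirectedCycleCover C →
        CycleDecomp.IsLight (1 / CycleDecomp.eta k ε) C w →
        ∀ l : List (Fin n × Fin n), (l.map CycleDecomp.toUndirected).Nodup →
          (l.map CycleDecomp.toUndirected).toFinset = C →
          ∃ (M : CycleDecomp.Mem) (t : ℕ),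
            CycleDecomp.Run prog (CycleDecomp.initMem (CycleDecomp.encode l
              (fun i e => w i (CycleDecomp.toUndirected e)))) M t ∧
            t ≤ p.eval (CycleDecomp.inputSize (CycleDecomp.encode l
              (fun i e => w i (CycleDecomp.toUndirected e)))) ∧
            CycleDecomp.IsUndirectedDecomposition (2 / 3 - ε) C w
              (CycleDecomp.returnedEdges (l.map CycleDecomp.toUndirected) M)) := by
  open CycleDecomp in
  constructor
  · rcases lt_or_ge ε (1 / 2) with h | h
    · obtain ⟨prog, p, hp⟩ := exists_directed_algorithm hk hε h
      refine ⟨prog, p, ?_⟩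
      rintro n _ w hC hlight l hl rfl
      exact hp n w l hl hC hlight
    · refine ⟨.skip, 1, fun n C w _ _ l _ _ => ⟨_, 1, .skip _, by simp, ?_⟩⟩
      rw [returnedEdges_initMem]
      refine ⟨Finset.empty_subset _, ⟨by simp, by simp, fun v hv => ?_⟩,
        keepsFraction_empty (by linarith) w C⟩
      obtain ⟨u, hu, -⟩ := Relation.TransGen.head'_iff.1 hv
      exact Finset.notMem_empty _ hu
  · rcases lt_or_ge ε (2 / 3) with h | h
    · obtain ⟨prog, p, hp⟩ := exists_undirected_algorithm hk hε h
      refine ⟨prog, p, ?_⟩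
      rintro n _ w hC hlight l hl rfl
      exact hp n w l hl hC hlight
    · refine ⟨.skip, 1, fun n C w _ _ l _ _ => ⟨_, 1, .skip _, by simp, ?_⟩⟩
      rw [returnedEdges_initMem]
      refine ⟨Finset.empty_subset _, ⟨by simp, by simp [degree], ?_⟩,
        keepsFraction_empty (by linarith) w C⟩
      simp only [Finset.coe_empty, SimpleGraph.fromEdgeSet_empty]
      exact SimpleGraph.isAcyclic_bot
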